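/- **Conventions.** Fix a universe of small sets. Triangulated categories satisfy the octahedral axiom; unless stated otherwise the morphisms between two objects form a small set. Let $\mathcal T$ be a triangulated category with small coproducts and $\alpha$ a regular (infinite) cardinal. A full triangulated subcategory is *thick* if it is closed under direct factors; a thick subcategory is *localizing* if it is closed under small coproducts, and *$\alpha$-localizing* if it is closed under coproducts with fewer than $\alpha$ factors. $\operatorname{Loc}\mathcal G$ and $\operatorname{Loc}_\alpha\mathcal G$ denote the smallest localizing, respectively $\alpha$-localizing, subcategory containing a class $\mathcal G$ of objects. An object $X$ is *$\alpha$-small* if every morphism $X\to\coprod_{i\in I}Y_i$ ($I$ small) factors through $\coprod_{i\in J}Y_i$ for some $J\subseteq I$ with $\operatorname{card}J<\alpha$. $\mathcal T$ is *$\alpha$-well generated* if there is a small set $\mathcal G$ of $\alpha$-small objects which perfectly generates $\mathcal T$, that is: (PG1) no proper localizing subcategory of $\mathcal T$ contains $\mathcal G$; (PG2) for each small family $(X_i\to Y_i)_{i\in I}$ of morphisms such that $\mathcal T(C,X_i)\to\mathcal T(C,Y_i)$ is surjective for all $C\in\mathcal G$ and $i\in I$, the map $\mathcal T(C,\coprod_iX_i)\to\mathcal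 T(C,\coprod_iY_i)$ is surjective for all $C\in\mathcal G$. In this case $\mathcal T^\alpha:=\operatorname{Loc}_\alpha\mathcal G$ is the subcategory of *$\alpha$-compact* objects; it does not depend on the choice of $\mathcal G$. For a triangulated subcategory $\mathcal S\subseteq\mathcal T$, the quotient $\mathcal T/\mathcal S$ is the localization of $\mathcal T$ at the morphisms whose cone lies in $\mathcal S$, with its induced triangulated structure. **Theorem.** Let $\alpha$ be a regular cardinal, $\mathcal T$ an $\alpha$-well generated triangulated category, and $\mathcal S=\operatorname{Loc}\mathcal S_0$ the localizing subcategory generated by a class $\mathcal S_0$ of $\alpha$-compact objects of $\mathcal T$. 1. An object $X$ of $\mathcal T$ belongs to $\mathcal S$ if and only if every morphism $C\to X$ with $C\in\mathcal T^\alpha$ factors through some object of $\mathcal S\cap\mathcal T^\alpha$. 2. The triangulated categories $\mathcal S$ and $\mathcal T/\mathcal S$ are $\alpha$-well generated (in particular, the morphisms between two objects of $\mathcal T/\mathcal S$ form a small set). 3. We have $\mathcal S^\alpha=\mathcal S\cap\mathcal T^\alpha$, and the inclusion $\mathcal T^\alpha\to\mathcal T$ induces an exact functor $J\colon\mathcal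 T^\alpha/\mathcal S^\alpha\to\mathcal T/\mathcal S$, compatible with the exact quotient functors $\mathcal T^\alpha\to\mathcal T^\alpha/\mathcal S^\alpha$ and $\mathcal T\to\mathcal T/\mathcal S$, which is fully faithful. Moreover, $J$ takes values in $(\mathcal T/\mathcal S)^\alpha$, and every object of $(\mathcal T/\mathcal S)^\alpha$ is a direct factor of an object in the image of $J$. If $\alpha>\aleph_0$, the induced functor $\mathcal T^\alpha/\mathcal S^\alpha\to(\mathcal T/\mathcal S)^\alpha$ is an equivalence. -/

import Mathlib

/-!
# Localizing subcategories and well generated triangulated categories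

The fixed universe of small sets is `Type w`. A full subcategory of `C` is an
`ObjectProperty C`.
-/

open CategoryTheory CategoryTheory.Limits CategoryTheory.Pretriangulated

universe w v u

namespace WellGenerated

section Localizing

variable {C : Type u} [Category.{v} C] [HasZeroObject C] [HasShift C ℤ] [Preadditive C]
  [∀ n : ℤ, (shiftFunctor C n).Additive] [Pretriangulated C]

/-- A localizing subcategory: a thick subcategory (a triangulated subcategory closed under
direct factors) that is closed under small coproducts. -/
structure IsLocalizing (P : ObjectProperty C) : Prop where
  isTriangulated : P.IsTriangulated
  isStableUnderRetracts : P.IsStableUnderRetracts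
  closed_coproducts : ∀ J : Type w, P.IsClosedUnderColimitsOfShape (Discrete J)

/-- An `α`-localizing subcategory: a thick subcategory that is closed under coproducts with
fewer than `α` factors. -/
structure IsAlphaLocalizing (α : Cardinal.{w}) (P : ObjectProperty C) : Prop where
  isTriangulated : P.IsTriangulated
  isStableUnderRetracts : P.IsStableUnderRetracts
  closed_coproducts : ∀ J : Type w, Cardinal.mk J < α →
    P.IsClosedUnderColimitsOfShape (Discrete J)

/-- The smallest localizing subcategory containing `G`. -/
def Loc (G : ObjectProperty C) : ObjectProperty C :=
  fun X => ∀ P : ObjectProperty C, IsLocalizing.{w} P → G ≤ P → P X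

/-- The smallest `α`-localizing subcategory containing `G`. -/
def LocAlpha (α : Cardinal.{w}) (G : ObjectProperty C) : ObjectProperty C :=
  fun X => ∀ P : ObjectProperty C, IsAlphaLocalizing α P → G ≤ P → P X

theorem le_loc (G : ObjectProperty C) : G ≤ Loc.{w} G :=
  fun X hX _ _ h => h X hX

theorem le_locAlpha (α : Cardinal.{w}) (G : ObjectProperty C) : G ≤ LocAlpha α G :=
  fun X hX _ _ h => h X hX

/-- An intersection of thick subcategories is triangulated. -/
theorem isTriangulated_of_forall {R : ObjectProperty C → Prop}
    (hR : ∀ P, R P → P.IsTriangulated ∧ P.IsStableUnderRetracts) :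
    ObjectProperty.IsTriangulated (fun X : C => ∀ P, R P → P X) := by
  have hiso : ∀ P, R P → P.IsClosedUnderIsomorphisms := fun P hP => by
    have := (hR P hP).2
    infer_instance
  have : ObjectProperty.IsClosedUnderIsomorphisms (fun X : C => ∀ P, R P → P X) :=
    ⟨fun e hX P hP => by
      have := hiso P hP
      exact P.prop_of_iso e (hX P hP)⟩
  exact
  { exists_zero := ⟨(HasZeroObject.zero (C := C)).choose, (HasZeroObject.zero (C := C)).choose_spec, fun P hP => by
      have := hiso P hP
      have := (hR P hP).1
      exact P.prop_zero⟩
    isStableUnderShiftBy := fun n => ⟨fun X hX P hP => by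
      have := (hR P hP).1
      exact P.le_shift n X (hX P hP)⟩
    toIsTriangulatedClosed₂ := .mk' fun T hT h₁ h₃ P hP => by
      have := hiso P hP
      have := (hR P hP).1
      exact P.ext_of_isTriangulatedClosed₂ T hT (h₁ P hP) (h₃ P hP) }

theorem isLocalizing_loc (G : ObjectProperty C) : IsLocalizing.{w} (Loc.{w} G) where
  isTriangulated := by
    have h := isTriangulated_of_forall
      (R := fun P : ObjectProperty C => IsLocalizing.{w} P ∧ G ≤ P) fun P hP => ⟨hP.1.1, hP.1.2⟩
    have e : Loc.{w} G = fun X : C => ∀ P, (IsLocalizing.{w} P ∧ G ≤ P) → P X := by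
      ext X
      exact ⟨fun h P hP => h P hP.1 hP.2, fun h P hP hG => h P ⟨hP, hG⟩⟩
    rw [e]
    exact h
  isStableUnderRetracts := ⟨fun r hY P hP hG => by
    have := hP.isStableUnderRetracts
    exact P.prop_of_retract r (hY P hP hG)⟩
  closed_coproducts J := ⟨fun X ⟨p⟩ P hP hG => by
    have := hP.closed_coproducts J
    exact P.prop_of_isColimit p.isColimit fun j => p.prop_diag_obj j P hP hG⟩

theorem isAlphaLocalizing_locAlpha (α : Cardinal.{w}) (G : ObjectProperty C) :
    IsAlphaLocalizing α (LocAlpha α G) where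
  isTriangulated := by
    have h := isTriangulated_of_forall
      (R := fun P : ObjectProperty C => IsAlphaLocalizing α P ∧ G ≤ P)
      fun P hP => ⟨hP.1.1, hP.1.2⟩
    have e : LocAlpha α G = fun X : C => ∀ P, (IsAlphaLocalizing α P ∧ G ≤ P) → P X := by
      ext X
      exact ⟨fun h P hP => h P hP.1 hP.2, fun h P hP hG => h P ⟨hP, hG⟩⟩
    rw [e]
    exact h
  isStableUnderRetracts := ⟨fun r hY P hP hG => by
    have := hP.isStableUnderRetracts
    exact P.prop_of_retract r (hY P hP hG)⟩
  closed_coproducts J hJ := ⟨fun X ⟨p⟩ P hP hG => by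
    have := hP.closed_coproducts J hJ
    exact P.prop_of_isColimit p.isColimit fun j => p.prop_diag_obj j P hP hG⟩

instance (G : ObjectProperty C) : (Loc.{w} G).IsTriangulated :=
  (isLocalizing_loc G).isTriangulated

instance (G : ObjectProperty C) : (Loc.{w} G).IsStableUnderRetracts :=
  (isLocalizing_loc G).isStableUnderRetracts

instance (α : Cardinal.{w}) (G : ObjectProperty C) : (LocAlpha α G).IsTriangulated :=
  (isAlphaLocalizing_locAlpha α G).isTriangulated

instance (α : Cardinal.{w}) (G : ObjectProperty C) : (LocAlpha α G).IsStableUnderRetracts :=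
  (isAlphaLocalizing_locAlpha α G).isStableUnderRetracts

end Localizing

section Generators

variable {C : Type u} [Category.{v} C]

/-- `X` is `α`-small: every morphism from `X` to a small coproduct `∐ i ∈ I, Y i` factors through
`∐ j ∈ J, Y j` for some subset `J ⊆ I` of cardinality less than `α`. -/
def IsAlphaSmall (α : Cardinal.{w}) (X : C) : Prop :=
  ∀ (I : Type w) (Y : I → C) (c : Cofan Y) (_ : IsColimit c) (f : X ⟶ c.pt),
    ∃ J : Set I, Cardinal.mk J < α ∧
      ∃ (d : Cofan fun j : J => Y j) (hd : IsColimit d) (g : X ⟶ d.pt),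
        g ≫ Cofan.IsColimit.desc hd (fun j => c.inj j) = f

/-- The condition on `G` that, for every small family of morphisms `φ i : X i ⟶ Y i`, if
`Hom(A, X i) → Hom(A, Y i)` is surjective for all `A` in `G` and all `i`, then
`Hom(A, ∐ X i) → Hom(A, ∐ Y i)` is surjective for all `A` in `G`. -/
def IsPerfectClass (G : ObjectProperty C) : Prop :=
  ∀ (I : Type w) (X Y : I → C) (φ : ∀ i, X i ⟶ Y i)
    (c : Cofan X) (hc : IsColimit c) (d : Cofan Y) (_ : IsColimit d),
    (∀ A, G A → ∀ i, Function.Surjective fun f : A ⟶ X i => f ≫ φ i) →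
    ∀ A, G A → Function.Surjective fun f : A ⟶ c.pt =>
      f ≫ Cofan.IsColimit.desc hc (fun i => φ i ≫ d.inj i)

variable [HasZeroObject C] [HasShift C ℤ] [Preadditive C]
  [∀ n : ℤ, (shiftFunctor C n).Additive] [Pretriangulated C]

/-- The triangulated category `C` (with small morphism sets and small coproducts) is
`α`-well generated by `G`: it is perfectly generated by `G`, and `G` is a small set of
`α`-small objects. In that case the objects of `LocAlpha α G` are the `α`-compact objects
of `C`. -/
structure IsWellGeneratedBy (α : Cardinal.{w}) (G : ObjectProperty C) : Prop where
  locallySmall : LocallySmall.{w} C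
  hasCoproducts : HasCoproducts.{w} C
  small : ObjectProperty.Small.{w} G
  isAlphaSmall : ∀ A, G A → IsAlphaSmall α A
  generates : ∀ P : ObjectProperty C, IsLocalizing.{w} P → G ≤ P → ∀ X, P X
  isPerfectClass : IsPerfectClass.{w} G

variable (C) in
/-- `C` is an `α`-well generated triangulated category. -/
def IsWellGenerated (α : Cardinal.{w}) : Prop :=
  ∃ G : ObjectProperty C, IsWellGeneratedBy α G

end Generators

end WellGenerated

open WellGenerated

/-! Everything rests on one property of α-compact objects (`IsDecomposable`): a morphism from such
an object to ∐ Y i factors through a coproduct of morphisms D i ⟶ Y i with all D i α-compact and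
fewer than α of them nonzero. For the generators it follows from α-smallness and (PG2) together
(`isDecomposable_of_isPerfectClass`). It passes to shifts, extensions, retracts and coproducts of
fewer than α objects, hence to all of T^α. Since it gives back α-smallness and (PG2), well
generation reduces to finding an essentially small generating class that decomposes into itself
(`exists_isWellGeneratedBy`).

By decomposability, the objects X such that every morphism from T^α to X factors through Loc_α S₀
form a localizing subcategory. It contains S₀, hence S (`loc_le_factorsThrough`). Applied to
identities, this gives S ∩ T^α = Loc_α S₀; applied to the pieces D i, it gives decompositions inside
S; and it is Verdier's criterion for J to be fully faithful.

The criterion also lets fractions with source in T^α have their middle object in T^α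
(`exists_Q_fraction`). Hence morphisms out of images of α-compact objects form small sets, and
decompositions descend to T/S. If X satisfies the factorization condition of part 1, then all
morphisms in T/S from these images to shifts of X vanish. As they generate, X becomes zero in T/S,
so its identity factors through S.

Finally, the image of T^α in T/S is triangulated and closed under coproducts of fewer than α
objects, so its retract closure is α-localizing and equals (T/S)^α. If α > ℵ₀, countable coproducts
already split idempotents, and no retracts are needed. -/

namespace WellGenerated

/-! ### Coproduct cofans -/

section Cofan

variable {C : Type*} [Category* C] {I : Type*}

theorem prop_cofan_pt (P : ObjectProperty C) [P.IsClosedUnderColimitsOfShape (Discrete I)]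
    {Y : I → C} {c : Cofan Y} (hc : IsColimit c) (h : ∀ i, P (Y i)) : P c.pt :=
  P.prop_of_isColimit hc fun i => h i.as

theorem isClosedUnderColimitsOfShape_discrete {P : ObjectProperty C}
    (h : ∀ (Y : I → C) (c : Cofan Y) (_ : IsColimit c), (∀ i, P (Y i)) → P c.pt) :
    P.IsClosedUnderColimitsOfShape (Discrete I) := by
  refine ⟨fun X ⟨p⟩ => ?_⟩
  let c : Cofan fun i => p.diag.obj ⟨i⟩ := Cofan.mk X fun i => p.ι.app ⟨i⟩
  have hc : IsColimit c := Cofan.IsColimit.mk _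
    (fun t => p.isColimit.desc ⟨t.pt, Discrete.natTrans fun i => t.inj i.as⟩)
    (fun t i => p.isColimit.fac _ _)
    (fun t m hm => p.isColimit.hom_ext fun i => by
      rw [p.isColimit.fac]
      exact hm i.as)
  exact h _ c hc fun i => p.prop_diag_obj _

variable {D : Type*} [Category* D]

/-- The image of a cofan under a functor. -/
abbrev mapCofan (F : C ⥤ D) {Y : I → C} (c : Cofan Y) : Cofan fun i => F.obj (Y i) :=
  Cofan.mk (F.obj c.pt) fun i => F.map (c.inj i)

/-- A functor that preserves coproducts maps coproduct cofans to coproduct cofans. -/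
noncomputable def isColimitMapCofan (F : C ⥤ D) {Y : I → C} {c : Cofan Y} (hc : IsColimit c)
    [PreservesColimitsOfShape (Discrete I) F] : IsColimit (mapCofan F c) :=
  Cofan.isColimitMapCoconeEquiv F Y c (isColimitOfPreserves F hc)

/-- A cofan on objects isomorphic to the given ones. -/
abbrev isoCofan {Y Z : I → C} (e : ∀ i, Z i ≅ Y i) (c : Cofan Y) : Cofan Z :=
  Cofan.mk c.pt fun i => (e i).hom ≫ c.inj i

/-- Coproduct cofans can be transported along isomorphisms of the summands. -/
noncomputable def isColimitIsoCofan {Y Z : I → C} (e : ∀ i, Z i ≅ Y i) {c : Cofan Y}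
    (hc : IsColimit c) : IsColimit (isoCofan e c) :=
  Cofan.IsColimit.mk _ (fun t => Cofan.IsColimit.desc hc fun i => (e i).inv ≫ t.inj i)
    (fun t i => by simp [Cofan.IsColimit.fac])
    (fun t m hm => Cofan.IsColimit.hom_ext hc _ _ fun i => by
      simp [Cofan.IsColimit.fac, ← hm i])

end Cofan

/-! ### Exactness properties of distinguished triangles -/

section Triangle

variable {C : Type u} [Category.{v} C] [HasZeroObject C] [HasShift C ℤ] [Preadditive C]
  [∀ n : ℤ, (shiftFunctor C n).Additive] [Pretriangulated C]
  {X Y Z : C} {f : X ⟶ Y} {g : Y ⟶ Z} {h : Z ⟶ X⟦(1 : ℤ)⟧}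

theorem distTriang_comp₁₂ (hT : Triangle.mk f g h ∈ distTriang C) : f ≫ g = 0 :=
  comp_distTriang_mor_zero₁₂ _ hT

theorem distTriang_comp₂₃ (hT : Triangle.mk f g h ∈ distTriang C) : g ≫ h = 0 :=
  comp_distTriang_mor_zero₂₃ _ hT

theorem distTriang_comp₃₁ (hT : Triangle.mk f g h ∈ distTriang C) : h ≫ f⟦(1 : ℤ)⟧' = 0 :=
  comp_distTriang_mor_zero₃₁ _ hT

theorem exists_desc₂ (hT : Triangle.mk f g h ∈ distTriang C) {A : C} (z : Y ⟶ A) (hz : f ≫ z = 0) :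
    ∃ t : Z ⟶ A, z = g ≫ t :=
  Triangle.yoneda_exact₂ _ hT z hz

theorem exists_desc₃ (hT : Triangle.mk f g h ∈ distTriang C) {A : C} (z : Z ⟶ A) (hz : g ≫ z = 0) :
    ∃ t : X⟦(1 : ℤ)⟧ ⟶ A, z = h ≫ t :=
  Triangle.yoneda_exact₃ _ hT z hz

theorem exists_desc₁ (hT : Triangle.mk f g h ∈ distTriang C) {A : C} (z : X⟦(1 : ℤ)⟧ ⟶ A)
    (hz : h ≫ z = 0) : ∃ t : Y⟦(1 : ℤ)⟧ ⟶ A, z = f⟦(1 : ℤ)⟧' ≫ t := by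
  obtain ⟨t, ht⟩ := exists_desc₃ (rot_of_distTriang _ hT) z hz
  exact ⟨-t, by rw [ht]; exact (Preadditive.neg_comp ..).trans (Preadditive.comp_neg ..).symm⟩

theorem exists_lift₂ (hT : Triangle.mk f g h ∈ distTriang C) {A : C} (x : A ⟶ Y) (hx : x ≫ g = 0) :
    ∃ y : A ⟶ X, x = y ≫ f :=
  Triangle.coyoneda_exact₂ _ hT x hx

theorem exists_lift₃ (hT : Triangle.mk f g h ∈ distTriang C) {A : C} (x : A ⟶ Z) (hx : x ≫ h = 0) :
    ∃ y : A ⟶ Y, x = y ≫ g :=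
  Triangle.coyoneda_exact₃ _ hT x hx

theorem exists_completion₂ (hT : Triangle.mk f g h ∈ distTriang C) {Y' Z' : C} {f' : X ⟶ Y'}
    {g' : Y' ⟶ Z'} {h' : Z' ⟶ X⟦(1 : ℤ)⟧} (hT' : Triangle.mk f' g' h' ∈ distTriang C) (c : Z ⟶ Z')
    (hc : h = c ≫ h') : ∃ b : Y ⟶ Y', f ≫ b = f' ∧ g ≫ c = b ≫ g' := by
  obtain ⟨b, hb, hb'⟩ := complete_distinguished_triangle_morphism₂ _ _ hT hT' (𝟙 X) c
    ((congrArg _ (CategoryTheory.Functor.map_id _ _)).trans ((Category.comp_id h).trans hc))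
  exact ⟨b, hb.trans (Category.id_comp f'), hb'⟩

theorem distTriang_of_iso₃ (hT : Triangle.mk f g h ∈ distTriang C) {Z' : C} (e : Z' ≅ Z)
    {g' : Y ⟶ Z'} {h' : Z' ⟶ X⟦(1 : ℤ)⟧} (hg : g' ≫ e.hom = g) (hh : e.hom ≫ h = h') :
    Triangle.mk f g' h' ∈ distTriang C :=
  isomorphic_distinguished _ hT _ (Triangle.isoMk (Triangle.mk f g' h') (Triangle.mk f g h)
    (Iso.refl X) (Iso.refl Y) e ((Category.comp_id f).trans (Category.id_comp f).symm)
    (hg.trans (Category.id_comp g).symm)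
    (((congrArg _ (CategoryTheory.Functor.map_id _ _)).trans (Category.comp_id h')).trans hh.symm))

end Triangle

/-! ### Coproducts of distinguished triangles -/

section CoproductTriangle

variable {C : Type u} [Category.{v} C] [HasZeroObject C] [HasShift C ℤ] [Preadditive C]
  [∀ n : ℤ, (shiftFunctor C n).Additive] [Pretriangulated C]

/-- A coproduct of distinguished triangles is distinguished. -/
theorem exists_cofan_triangle {I : Type*} {X Y Z : I → C} (f : ∀ i, X i ⟶ Y i) (g : ∀ i, Y i ⟶ Z i)
    (h : ∀ i, Z i ⟶ (X i)⟦(1 : ℤ)⟧) (hT : ∀ i, Triangle.mk (f i) (g i) (h i) ∈ distTriang C)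
    {c₁ : Cofan X} (hc₁ : IsColimit c₁) {c₂ : Cofan Y} (hc₂ : IsColimit c₂)
    {c₃ : Cofan Z} (hc₃ : IsColimit c₃) :
    Triangle.mk (Cofan.IsColimit.desc hc₁ fun i => f i ≫ c₂.inj i)
      (Cofan.IsColimit.desc hc₂ fun i => g i ≫ c₃.inj i)
      (Cofan.IsColimit.desc hc₃ fun i => h i ≫ (c₁.inj i)⟦(1 : ℤ)⟧') ∈ distTriang C := by
  set m₁ := Cofan.IsColimit.desc hc₁ fun i => f i ≫ c₂.inj i with hm₁
  set m₂ := Cofan.IsColimit.desc hc₂ fun i => g i ≫ c₃.inj i with hm₂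
  set m₃ := Cofan.IsColimit.desc hc₃ fun i => h i ≫ (c₁.inj i)⟦(1 : ℤ)⟧' with hm₃
  have fac₁ (i : I) : c₁.inj i ≫ m₁ = f i ≫ c₂.inj i := Cofan.IsColimit.fac ..
  have fac₂ (i : I) : c₂.inj i ≫ m₂ = g i ≫ c₃.inj i := Cofan.IsColimit.fac ..
  have fac₃ (i : I) : c₃.inj i ≫ m₃ = h i ≫ (c₁.inj i)⟦(1 : ℤ)⟧' := Cofan.IsColimit.fac ..
  obtain ⟨W, p, q, hW⟩ := distinguished_cocone_triangle m₁
  have hφ (i : I) : ∃ φ : Z i ⟶ W, g i ≫ φ = c₂.inj i ≫ p ∧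
      h i ≫ (c₁.inj i)⟦(1 : ℤ)⟧' = φ ≫ q :=
    complete_distinguished_triangle_morphism _ _ (hT i) hW (c₁.inj i) (c₂.inj i) (fac₁ i).symm
  choose φ hφ₁ hφ₂ using hφ
  let Φ : c₃.pt ⟶ W := Cofan.IsColimit.desc hc₃ φ
  have facΦ (i : I) : c₃.inj i ≫ Φ = φ i := Cofan.IsColimit.fac ..
  have hΦ₂ : m₂ ≫ Φ = p := Cofan.IsColimit.hom_ext hc₂ _ _ fun i => by
    rw [reassoc_of% fac₂, facΦ, hφ₁]
  have hΦ₃ : Φ ≫ q = m₃ := Cofan.IsColimit.hom_ext hc₃ _ _ fun i => by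
    rw [reassoc_of% facΦ, fac₃, hφ₂]
  let s₁ := isColimitMapCofan (shiftFunctor C (1 : ℤ)) hc₁
  let s₂ := isColimitMapCofan (shiftFunctor C (1 : ℤ)) hc₂
  -- The five lemma by hand: for each A, the exact Hom(-, A) sequence of the cone triangle is
  -- compared with the product of those of the given triangles. The shifted terms match because the
  -- shift preserves coproducts.
  have hΦ : IsIso Φ := by
    refine isIso_of_coyoneda_map_bijective _ fun A => ⟨?_, ?_⟩
    · suffices ∀ z : W ⟶ A, Φ ≫ z = 0 → z = 0 by
        intro a b hab
        rw [← sub_eq_zero]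
        refine this _ ?_
        rw [Preadditive.comp_sub, sub_eq_zero]
        exact hab
      intro z hz
      obtain ⟨t, ht⟩ := exists_desc₃ hW z (by rw [← hΦ₂, Category.assoc, hz, comp_zero])
      have hs (i : I) : ∃ s : (Y i)⟦(1 : ℤ)⟧ ⟶ A,
          (c₁.inj i)⟦(1 : ℤ)⟧' ≫ t = (f i)⟦(1 : ℤ)⟧' ≫ s :=
        exists_desc₁ (hT i) _ (by
          rw [reassoc_of% hφ₂ i, ← ht, ← facΦ i, Category.assoc, hz, comp_zero])
      choose s hs using hs
      have hs' (i : I) : (c₂.inj i)⟦(1 : ℤ)⟧' ≫ Cofan.IsColimit.desc s₂ s = s i :=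
        Cofan.IsColimit.fac s₂ s i
      have ht' : t = m₁⟦(1 : ℤ)⟧' ≫ Cofan.IsColimit.desc s₂ s :=
        Cofan.IsColimit.hom_ext s₁ _ _ fun i => by
          change (c₁.inj i)⟦(1 : ℤ)⟧' ≫ t = (c₁.inj i)⟦(1 : ℤ)⟧' ≫ _
          rw [hs, ← Functor.map_comp_assoc, fac₁, Functor.map_comp_assoc, hs']
      rw [ht, ht', reassoc_of% distTriang_comp₃₁ hW, zero_comp]
    · intro y
      obtain ⟨z₀, hz₀⟩ := exists_desc₂ hW (m₂ ≫ y) (Cofan.IsColimit.hom_ext hc₁ _ _ fun i => by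
        rw [reassoc_of% fac₁, reassoc_of% fac₂, reassoc_of% distTriang_comp₁₂ (hT i), zero_comp,
          comp_zero])
      have ht (i : I) : ∃ t : (X i)⟦(1 : ℤ)⟧ ⟶ A, c₃.inj i ≫ (y - Φ ≫ z₀) = h i ≫ t :=
        exists_desc₃ (hT i) _ (by
          rw [← reassoc_of% fac₂, Preadditive.comp_sub, hz₀, reassoc_of% hΦ₂, sub_self, comp_zero])
      choose t ht using ht
      let τ : c₁.pt⟦(1 : ℤ)⟧ ⟶ A := Cofan.IsColimit.desc s₁ t
      have hτ (i : I) : (c₁.inj i)⟦(1 : ℤ)⟧' ≫ τ = t i := Cofan.IsColimit.fac s₁ t i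
      refine ⟨z₀ + q ≫ τ, Cofan.IsColimit.hom_ext hc₃ _ _ fun i => ?_⟩
      have := ht i
      rw [Preadditive.comp_sub, sub_eq_iff_eq_add] at this
      change c₃.inj i ≫ Φ ≫ (z₀ + q ≫ τ) = c₃.inj i ≫ y
      rw [this, Preadditive.comp_add, Preadditive.comp_add, reassoc_of% hΦ₃, reassoc_of% fac₃, hτ,
        add_comm]
  exact distTriang_of_iso₃ hW (asIso Φ) hΦ₂ hΦ₃

end CoproductTriangle

end WellGenerated

namespace WellGenerated

/-! ### Decomposable objects, smallness and perfectness -/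

section Decomposable

variable {C : Type u} [Category.{v} C]

/-- Every morphism from `A` to a small coproduct `∐ Y i` factors through a coproduct `∐ D i` of
morphisms `D i ⟶ Y i` such that all `D i` satisfy `P` and fewer than `α` of them are nonzero. -/
def IsDecomposable (α : Cardinal.{w}) (P : ObjectProperty C) : ObjectProperty C := fun A =>
  ∀ (I : Type w) (Y : I → C) (c : Cofan Y) (_ : IsColimit c) (f : A ⟶ c.pt),
    ∃ (J : Set I) (D : I → C) (k : ∀ i, D i ⟶ Y i) (d : Cofan D) (hd : IsColimit d) (g : A ⟶ d.pt),
      Cardinal.mk J < α ∧ (∀ i, P (D i)) ∧ (∀ i ∉ J, IsZero (D i)) ∧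
        g ≫ Cofan.IsColimit.desc hd (fun i => k i ≫ c.inj i) = f

theorem IsDecomposable.isAlphaSmall [HasCoproducts.{w} C] [HasZeroMorphisms C] {α : Cardinal.{w}}
    {P : ObjectProperty C} {A : C} (hA : IsDecomposable α P A) : IsAlphaSmall α A := by
  classical
  intro I Y c hc f
  obtain ⟨J, D, k, d, hd, g, hJ, hP, hz, fac⟩ := hA I Y c hc f
  let e := coproductIsCoproduct fun j : J => Y j
  refine ⟨J, hJ, _, e, g ≫ Cofan.IsColimit.desc hd fun i =>
    if h : i ∈ J then k i ≫ Sigma.ι (fun j : J => Y j) ⟨i, h⟩ else 0, ?_⟩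
  rw [← fac, Category.assoc]
  congr 1
  refine Cofan.IsColimit.hom_ext hd _ _ fun i => ?_
  rw [Cofan.IsColimit.fac, ← Category.assoc, Cofan.IsColimit.fac]
  by_cases h : i ∈ J
  · have := Cofan.IsColimit.fac e (fun j : J => c.inj j) ⟨i, h⟩
    dsimp at this
    simp only [h, dif_pos, Category.assoc]
    rw [this]
  · exact (hz i h).eq_of_src _ _

/-- A class of objects whose objects decompose into objects of the class is perfect. -/
theorem isPerfectClass_of_isDecomposable {α : Cardinal.{w}} {P G : ObjectProperty C}
    (hP : P ≤ G.isoClosure) (hG : G ≤ IsDecomposable α P) : IsPerfectClass.{w} G := by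
  intro I X Y φ c hc d hd h A hA f
  obtain ⟨J, D, k, e, he, g, -, hD, -, fac⟩ := hG A hA I Y d hd f
  -- Each D i is isomorphic to an object of G, so k i lifts along φ i separately for every i.
  have hl (i : I) : ∃ l : D i ⟶ X i, l ≫ φ i = k i := by
    obtain ⟨B, hB, ⟨ε⟩⟩ := hP _ (hD i)
    obtain ⟨l, hl⟩ := h B hB i (ε.inv ≫ k i)
    exact ⟨ε.hom ≫ l, by simp only [Category.assoc] at hl ⊢; rw [hl, Iso.hom_inv_id_assoc]⟩
  choose l hl using hl
  refine ⟨g ≫ Cofan.IsColimit.desc he fun i => l i ≫ c.inj i, ?_⟩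
  dsimp only
  rw [← fac, Category.assoc]
  congr 1
  refine Cofan.IsColimit.hom_ext he _ _ fun i => ?_
  rw [Cofan.IsColimit.fac, ← Category.assoc, Cofan.IsColimit.fac, Category.assoc,
    Cofan.IsColimit.fac, reassoc_of% hl]

theorem IsDecomposable.of_retract {α : Cardinal.{w}} {P : ObjectProperty C} {A B : C}
    (r : Retract A B) (hB : IsDecomposable α P B) : IsDecomposable α P A := by
  intro I Y c hc f
  obtain ⟨J, D, k, d, hd, g, hJ, hP, hz, fac⟩ := hB I Y c hc (r.r ≫ f)
  exact ⟨J, D, k, d, hd, r.i ≫ g, hJ, hP, hz, by rw [Category.assoc, fac, r.retract_assoc]⟩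

instance {α : Cardinal.{w}} {P : ObjectProperty C} :
    (IsDecomposable α P).IsStableUnderRetracts := ⟨fun r h => h.of_retract r⟩

theorem IsDecomposable.of_isZero [HasCoproducts.{w} C] [HasZeroMorphisms C] [HasZeroObject C]
    {α : Cardinal.{w}} (hα : 0 < α)
    {P : ObjectProperty C} [P.IsClosedUnderIsomorphisms] [P.ContainsZero] {A : C} (hA : IsZero A) :
    IsDecomposable α P A := fun I Y c hc f =>
  ⟨∅, fun _ => A, fun _ => hA.to_ _, _, coproductIsCoproduct _, hA.to_ _, by simpa using hα,
    fun _ => P.prop_of_isZero hA, fun _ _ => hA, hA.eq_of_src _ _⟩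

/-- The decompositions are added index by index: at i stands ∐ j, D j i. It vanishes outside the
union of the sets J j, which has fewer than α elements because α is regular. -/
theorem IsDecomposable.cofan_pt [HasCoproducts.{w} C] [HasZeroMorphisms C]
    {α : Cardinal.{w}} (hα : α.IsRegular)
    {P : ObjectProperty C} (hP : ∀ J : Type w, Cardinal.mk J < α →
      P.IsClosedUnderColimitsOfShape (Discrete J)) {K : Type w} (hK : Cardinal.mk K < α)
    {A : K → C} {b : Cofan A} (hb : IsColimit b) (hA : ∀ j, IsDecomposable α P (A j)) :
    IsDecomposable α P b.pt := by
  intro I Y c hc f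
  choose J D k d hd g hJ hD hz fac using fun j => hA j I Y c hc (b.inj j ≫ f)
  have := hP K hK
  let e i := coproductIsCoproduct fun j => D j i
  let E i := ∐ fun j => D j i
  refine ⟨⋃ j, J j, E, fun i => Cofan.IsColimit.desc (e i) fun j => k j i, _,
    coproductIsCoproduct E, Cofan.IsColimit.desc hb fun j => g j ≫
      Cofan.IsColimit.desc (hd j) fun i => Sigma.ι (fun j => D j i) j ≫ Sigma.ι E i, ?_, ?_, ?_, ?_⟩
  · exact (Cardinal.card_iUnion_lt_iff_forall_of_isRegular hα hK).2 hJ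
  · exact fun i => prop_cofan_pt P (e i) fun j => hD j i
  · intro i hi
    rw [IsZero.iff_id_eq_zero]
    exact Cofan.IsColimit.hom_ext (e i) _ _ fun j =>
      (hz j i fun h => hi (Set.mem_iUnion_of_mem j h)).eq_of_src _ _
  · refine Cofan.IsColimit.hom_ext hb _ _ fun j => ?_
    rw [← fac, ← Category.assoc, Cofan.IsColimit.fac, Category.assoc]
    congr 1
    refine Cofan.IsColimit.hom_ext (hd j) _ _ fun i => ?_
    rw [Cofan.IsColimit.fac, ← Category.assoc, Cofan.IsColimit.fac]
    have h₁ := Cofan.IsColimit.fac (coproductIsCoproduct E)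
      (fun i => Cofan.IsColimit.desc (e i) (fun j => k j i) ≫ c.inj i) i
    have h₂ := Cofan.IsColimit.fac (e i) (fun j => k j i) j
    dsimp at h₁ h₂ ⊢
    rw [Category.assoc, h₁, reassoc_of% h₂]

/-- Decompose the transpose A ⟶ G(∐ Y i) = ∐ G(Y i) and transpose back; F preserves coproducts as a
left adjoint. This serves the shift functors. -/
theorem IsDecomposable.of_adjunction [HasZeroMorphisms C] {α : Cardinal.{w}} {P : ObjectProperty C}
    {F G : C ⥤ C} (adj : F ⊣ G) [∀ I : Type w, PreservesColimitsOfShape (Discrete I) G]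
    [F.PreservesZeroMorphisms] (hF : ∀ X, P X → P (F.obj X))
    {A : C} (hA : IsDecomposable α P A) : IsDecomposable α P (F.obj A) := by
  intro I Y c hc f
  have := adj.leftAdjoint_preservesColimits
  obtain ⟨J, D, k, d, hd, g, hJ, hP, hz, fac⟩ :=
    hA I _ _ (isColimitMapCofan G hc) (adj.homEquiv _ _ f)
  refine ⟨J, fun i => F.obj (D i), fun i => (adj.homEquiv _ _).symm (k i), _,
    isColimitMapCofan F hd, F.map g, hJ, fun i => hF _ (hP i),
    fun i hi => F.map_isZero (hz i hi), ?_⟩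
  rw [← (adj.homEquiv _ _).symm_apply_apply f, ← fac, adj.homEquiv_naturality_left_symm]
  congr 1
  refine Cofan.IsColimit.hom_ext (isColimitMapCofan F hd) _ _ fun i => ?_
  rw [Cofan.IsColimit.fac]
  change _ = F.map (d.inj i) ≫ _
  rw [← adj.homEquiv_naturality_left_symm, Cofan.IsColimit.fac]
  exact (adj.homEquiv_naturality_right_symm _ _).symm

open Cardinal in
/-- If `G` is a small perfect class of `α`-small objects, then its objects decompose into objects
of any class that contains `G` and is closed under coproducts with fewer than `α` factors. -/
theorem isDecomposable_of_isPerfectClass [LocallySmall.{w} C] [HasCoproducts.{w} C]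
    [HasZeroMorphisms C] {α : Cardinal.{w}} {G : ObjectProperty C} [ObjectProperty.Small.{w} G]
    (hs : ∀ A, G A → IsAlphaSmall α A) (hG : IsPerfectClass.{w} G) {P : ObjectProperty C}
    (hGP : G ≤ P) (hP : ∀ J : Type w, #J < α → P.IsClosedUnderColimitsOfShape (Discrete J)) :
    G ≤ IsDecomposable α P := by
  intro A hA I Y c hc f
  let S := equivShrink.{w} (Subtype G)
  let H (B : C) (i : I) := equivShrink.{w} (B ⟶ Y i)
  -- K i indexes all morphisms z from objects of G to Y i. Their sum φ i : X i ⟶ Y i is surjective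
  -- on morphisms from G, so perfectness lifts f to ∐ X i. This is a coproduct of objects of G over
  -- pairs (i, κ), and smallness leaves fewer than α pairs.
  let K (i : I) : Type w := Σ B : Shrink.{w} (Subtype G), Shrink.{w} ((S.symm B).1 ⟶ Y i)
  let Z (i : I) (κ : K i) : C := (S.symm κ.1).1
  let z (i : I) (κ : K i) : Z i κ ⟶ Y i := (H _ i).symm κ.2
  let X (i : I) : C := ∐ Z i
  let x (i : I) := coproductIsCoproduct (Z i)
  let φ (i : I) : X i ⟶ Y i := Cofan.IsColimit.desc (x i) (z i)
  have hφ (i : I) (κ : K i) : Sigma.ι (Z i) κ ≫ φ i = z i κ := Cofan.IsColimit.fac (x i) (z i) κ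
  have hx := coproductIsCoproduct X
  obtain ⟨f', hf'⟩ := hG I X Y φ _ hx c hc (by
    intro B hB i b
    obtain ⟨β, rfl⟩ : ∃ β, B = (S.symm β).1 := ⟨S ⟨B, hB⟩, by simp⟩
    exact ⟨Sigma.ι (Z i) ⟨β, H _ i b⟩, (hφ i _).trans ((H _ i).symm_apply_apply b)⟩) A hA f
  let T := Cofan.isColimitTrans _ hx (fun i => Sigma.ι (Z i)) x
  obtain ⟨J, hJ, d, hd, g, fac⟩ := hs A hA _ _ _ T f'
  -- The remaining pairs are regrouped by their first component; D i is an empty coproduct when i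
  -- does not occur.
  let E (i : I) (κ : {κ : K i // ⟨i, κ⟩ ∈ J}) : C := Z i κ.1
  let e (i : I) := coproductIsCoproduct (E i)
  let D (i : I) : C := ∐ E i
  have hD := coproductIsCoproduct D
  refine ⟨Sigma.fst '' J, D, fun i => Cofan.IsColimit.desc (e i) fun κ => z i κ.1, _, hD,
    g ≫ Cofan.IsColimit.desc hd fun j => Sigma.ι (E j.1.1) ⟨j.1.2, j.2⟩ ≫ Sigma.ι D j.1.1,
    mk_image_le.trans_lt hJ, ?_, ?_, ?_⟩
  · intro i
    have := hP {κ : K i // ⟨i, κ⟩ ∈ J} ((mk_le_of_injective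
      (f := fun κ => (⟨⟨i, κ.1⟩, κ.2⟩ : J)) fun κ₁ κ₂ h => by simpa [Subtype.ext_iff] using h).trans_lt hJ)
    exact prop_cofan_pt P (e i) fun κ => hGP _ (S.symm κ.1.1).2
  · intro i hi
    rw [IsZero.iff_id_eq_zero]
    exact Cofan.IsColimit.hom_ext (e i) _ _ fun κ => (hi ⟨_, κ.2, rfl⟩).elim
  · dsimp only at hf'
    rw [← hf', ← fac, Category.assoc, Category.assoc]
    congr 1
    refine Cofan.IsColimit.hom_ext hd _ _ fun j => ?_
    simp only [← Category.assoc, Cofan.IsColimit.fac]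
    have h₁ := Cofan.IsColimit.fac hD
      (fun i => Cofan.IsColimit.desc (e i) (fun κ => z i κ.1) ≫ c.inj i) j.1.1
    have h₂ := Cofan.IsColimit.fac (e j.1.1) (fun κ => z j.1.1 κ.1) ⟨j.1.2, j.2⟩
    have h₃ := Cofan.IsColimit.fac hx (fun i => φ i ≫ c.inj i) j.1.1
    dsimp at h₁ h₂ h₃ ⊢
    simp only [Category.assoc]
    rw [h₁, h₃, reassoc_of% h₂, reassoc_of% hφ]

end Decomposable

/-! ### Decomposable objects form an α-localizing subcategory -/

section Triangulated

variable {C : Type u} [Category.{v} C] [HasZeroObject C] [HasShift C ℤ] [Preadditive C]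
  [∀ n : ℤ, (shiftFunctor C n).Additive] [Pretriangulated C]

open Cardinal in
-- Decompose u ≫ f through ∐ D i, and let W i be the cone of k i : D i ⟶ Y i. Then f induces A₃ ⟶ ∐
-- W i, which decomposes through ∐ E i. The extension F i of E i by D i with class E i ⟶ W i ⟶ (D
-- i)⟦1⟧ maps to Y i, and f factors through ∐ F i.
theorem IsDecomposable.of_distTriang [HasCoproducts.{w} C] {α : Cardinal.{w}} (hα : ℵ₀ ≤ α)
    {P : ObjectProperty C} [P.IsTriangulated] [P.IsClosedUnderIsomorphisms]
    {A₁ A₂ A₃ : C} {u : A₁ ⟶ A₂} {v : A₂ ⟶ A₃} {w' : A₃ ⟶ A₁⟦(1 : ℤ)⟧}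
    (hT : Triangle.mk u v w' ∈ distTriang C) (h₁ : IsDecomposable α P A₁)
    (h₃ : IsDecomposable α P A₃) : IsDecomposable α P A₂ := by
  intro I Y c hc f
  obtain ⟨J, D, k, d, hd, g, hJ, hPD, hzD, fac⟩ := h₁ I Y c hc (u ≫ f)
  choose W p q hW using fun i => distinguished_cocone_triangle (k i)
  have hw := coproductIsCoproduct W
  have hcT := exists_cofan_triangle k p q hW hd hc hw
  set m := Cofan.IsColimit.desc hd fun i => k i ≫ c.inj i with hm
  set m₂ := Cofan.IsColimit.desc hc fun i => p i ≫ (Cofan.mk _ (Sigma.ι W)).inj i with hm₂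
  set m₃ := Cofan.IsColimit.desc hw fun i => q i ≫ (d.inj i)⟦(1 : ℤ)⟧' with hm₃
  obtain ⟨h, hh⟩ := exists_desc₂ hT (f ≫ m₂) (by
    rw [← reassoc_of% fac, distTriang_comp₁₂ hcT, comp_zero])
  obtain ⟨J', E, l, e, he, g', hJ', hPE, hzE, fac'⟩ := h₃ I W _ hw h
  set ml := Cofan.IsColimit.desc he fun i => l i ≫ (Cofan.mk _ (Sigma.ι W)).inj i with hml
  choose F a b hF using fun i => distinguished_cocone_triangle₂ (l i ≫ q i)
  have ht (i : I) : ∃ t : F i ⟶ Y i, a i ≫ t = k i ∧ b i ≫ l i = t ≫ p i :=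
    exists_completion₂ (hF i) (hW i) (l i) rfl
  choose t ht₁ ht₂ using ht
  have hx := coproductIsCoproduct F
  have hcF := exists_cofan_triangle a b _ hF hd hx he
  set ma := Cofan.IsColimit.desc hd fun i => a i ≫ (Cofan.mk _ (Sigma.ι F)).inj i with hma
  set mb := Cofan.IsColimit.desc hx fun i => b i ≫ e.inj i with hmb
  set mc := Cofan.IsColimit.desc he fun i => (l i ≫ q i) ≫ (d.inj i)⟦(1 : ℤ)⟧' with hmc
  let mt := Cofan.IsColimit.desc hx fun i => t i ≫ c.inj i
  have hmt (i : I) : (Cofan.mk _ (Sigma.ι F)).inj i ≫ mt = t i ≫ c.inj i := Cofan.IsColimit.fac ..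
  have hmc' : mc = ml ≫ m₃ := Cofan.IsColimit.hom_ext he _ _ fun i => by
    rw [hmc, Cofan.IsColimit.fac, ← Category.assoc, hml, Cofan.IsColimit.fac, Category.assoc,
      Category.assoc, hm₃, Cofan.IsColimit.fac]
  have hma' : ma ≫ mt = m := Cofan.IsColimit.hom_ext hd _ _ fun i => by
    rw [← Category.assoc, hma, Cofan.IsColimit.fac, Category.assoc, Cofan.IsColimit.fac, hm,
      Cofan.IsColimit.fac, reassoc_of% ht₁]
  have hmb' : mb ≫ ml = mt ≫ m₂ := Cofan.IsColimit.hom_ext hx _ _ fun i => by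
    rw [← Category.assoc, hmb, Cofan.IsColimit.fac, Category.assoc, hml, Cofan.IsColimit.fac,
      reassoc_of% hmt, hm₂, Cofan.IsColimit.fac, reassoc_of% ht₂]
  -- The lift y is correct only after projecting to ∐ W i; the error f - y ≫ mt comes from some z
  -- into ∐ D i, and z ≫ ma corrects y.
  obtain ⟨y, hy⟩ := exists_lift₃ hcF (v ≫ g') (by
    rw [hmc', Category.assoc, reassoc_of% fac', ← reassoc_of% hh, distTriang_comp₂₃ hcT,
      comp_zero])
  obtain ⟨z, hz⟩ := exists_lift₂ hcT (f - y ≫ mt) (by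
    rw [Preadditive.sub_comp, Category.assoc, ← hmb', ← reassoc_of% hy, fac', hh, sub_self])
  refine ⟨J ∪ J', F, t, _, hx, y + z ≫ ma, ?_, ?_, ?_, ?_⟩
  · exact (mk_union_le _ _).trans_lt (add_lt_of_lt hα hJ hJ')
  · exact fun i => P.ext_of_isTriangulatedClosed₂ _ (hF i) (hPD i) (hPE i)
  · intro i hi
    exact Triangle.isZero₂_of_isZero₁₃ _ (hF i) (hzD i fun h => hi (.inl h))
      (hzE i fun h => hi (.inr h))
  · change (y + z ≫ ma) ≫ mt = f
    rw [Preadditive.add_comp, Category.assoc, hma', ← hz]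
    abel

theorem IsDecomposable.isAlphaLocalizing [HasCoproducts.{w} C] {α : Cardinal.{w}}
    (hα : α.IsRegular) {P : ObjectProperty C} (hP : IsAlphaLocalizing α P) :
    IsAlphaLocalizing α (IsDecomposable α P) := by
  have := hP.isTriangulated
  have := hP.isStableUnderRetracts
  exact
  { isTriangulated :=
    { exists_zero := ⟨_, isZero_zero C, .of_isZero hα.pos (isZero_zero C)⟩
      isStableUnderShiftBy := fun n => ⟨fun A hA =>
        hA.of_adjunction (shiftEquiv C n).toAdjunction fun X hX => P.le_shift n X hX⟩
      toIsTriangulatedClosed₂ := .mk' fun T hT h₁ h₃ => .of_distTriang hα.1 hT h₁ h₃ }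
    isStableUnderRetracts := inferInstance
    closed_coproducts := fun J hJ => isClosedUnderColimitsOfShape_discrete fun Y c hc h =>
      IsDecomposable.cofan_pt hα hP.closed_coproducts hJ hc h }

theorem locAlpha_le {α : Cardinal.{w}} {G P : ObjectProperty C} (hP : IsAlphaLocalizing α P)
    (h : G ≤ P) : LocAlpha α G ≤ P := fun _ hX => hX P hP h

theorem loc_le {G P : ObjectProperty C} (hP : IsLocalizing.{w} P)
    (h : G ≤ P) : Loc.{w} G ≤ P := fun _ hX => hX P hP h

/-- The generators decompose by perfectness and smallness, and the decomposable objects form an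
α-localizing subcategory. -/
theorem IsWellGeneratedBy.locAlpha_le_isDecomposable {α : Cardinal.{w}} (hα : α.IsRegular)
    {G : ObjectProperty C} (hG : IsWellGeneratedBy α G) :
    LocAlpha α G ≤ IsDecomposable α (LocAlpha α G) := by
  have := hG.locallySmall
  have := hG.hasCoproducts
  have := hG.small
  exact locAlpha_le (IsDecomposable.isAlphaLocalizing hα (isAlphaLocalizing_locAlpha α G))
    (isDecomposable_of_isPerfectClass hG.isAlphaSmall hG.isPerfectClass (le_locAlpha α G)
      (isAlphaLocalizing_locAlpha α G).closed_coproducts)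

end Triangulated

end WellGenerated

namespace WellGenerated

variable {C : Type u} [Category.{v} C] [HasZeroObject C] [HasShift C ℤ] [Preadditive C]
  [∀ n : ℤ, (shiftFunctor C n).Additive] [Pretriangulated C]

/-! ### Essential smallness of the α-compact objects -/

section EssentiallySmall

open Cardinal Ordinal ZeroObject

/-- An extension of B by A is determined up to isomorphism by its connecting morphism B ⟶ A⟦1⟧, and
these form small sets. -/
theorem essentiallySmall_extensionProduct [LocallySmall.{w} C] (P Q : ObjectProperty C)
    [ObjectProperty.EssentiallySmall.{w} P] [ObjectProperty.EssentiallySmall.{w} Q] :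
    ObjectProperty.EssentiallySmall.{w} (P.extensionProduct Q) := by
  obtain ⟨P', _, hP'⟩ := ObjectProperty.EssentiallySmall.exists_small_le'.{w} P
  obtain ⟨Q', _, hQ'⟩ := ObjectProperty.EssentiallySmall.exists_small_le'.{w} Q
  let K := Σ (A : Subtype P') (B : Subtype Q'), B.1 ⟶ A.1⟦(1 : ℤ)⟧
  have hK (κ : K) := distinguished_cocone_triangle₂ κ.2.2
  choose E a b hE using hK
  refine ⟨ObjectProperty.ofObj E, inferInstance, fun X hX => ?_⟩
  obtain ⟨A, B, f, g, h, hT, hA, hB⟩ := hX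
  obtain ⟨A', hA', ⟨e⟩⟩ := hP' _ hA
  obtain ⟨B', hB', ⟨e'⟩⟩ := hQ' _ hB
  let κ : K := ⟨⟨A', hA'⟩, ⟨B', hB'⟩, e'.inv ≫ h ≫ e.hom⟦(1 : ℤ)⟧'⟩
  exact ⟨E κ, ⟨κ⟩, ⟨Triangle.π₂.mapIso (isoTriangleOfIso₁₃ _ _ hT (hE κ) e e' (by
    change h ≫ e.hom⟦(1 : ℤ)⟧' = e'.hom ≫ e'.inv ≫ h ≫ e.hom⟦(1 : ℤ)⟧'
    rw [e'.hom_inv_id_assoc]))⟩⟩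

/-- One step in the construction of the `α`-localizing subcategory generated by `P`. -/
def locAlphaStep (α : Cardinal.{w}) (P : ObjectProperty C) : ObjectProperty C :=
  P.retractClosure ⊔ P.extensionProduct P ⊔ (⨆ n : ℤ, P.map (shiftFunctor C n)) ⊔
    P.colimitsClosure fun S : Set α.out => Discrete S

theorem locAlphaStep_essentiallySmall [LocallySmall.{w} C] (α : Cardinal.{w})
    (P : ObjectProperty C) [ObjectProperty.EssentiallySmall.{w} P] :
    ObjectProperty.EssentiallySmall.{w} (locAlphaStep α P) := by
  have := essentiallySmall_extensionProduct.{w} P P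
  have : Small.{w} ℤ := inferInstance
  have h : ObjectProperty.EssentiallySmall.{w}
    (P.colimitsClosure fun S : Set α.out => Discrete S) := inferInstance
  unfold locAlphaStep
  infer_instance

/-- The stages of the construction of the `α`-localizing subcategory generated by `P`. -/
def locAlphaStage (α : Cardinal.{w}) (P : ObjectProperty C) (β : Ordinal.{w}) :
    ObjectProperty C :=
  locAlphaStep α (P ⊔ ⨆ γ : Set.Iio β, locAlphaStage α P γ.1)
termination_by β
decreasing_by exact γ.2

theorem locAlphaStage_essentiallySmall [LocallySmall.{w} C] (α : Cardinal.{w})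
    (P : ObjectProperty C) [ObjectProperty.EssentiallySmall.{w} P] (β : Ordinal.{w}) :
    ObjectProperty.EssentiallySmall.{w} (locAlphaStage α P β) := by
  induction β using WellFoundedLT.induction with
  | _ β ih =>
    have (γ : Set.Iio β) := ih γ.1 γ.2
    rw [locAlphaStage]
    exact locAlphaStep_essentiallySmall α _

/-- Since α is regular, fewer than α objects from stages below α.ord have a common bound on their
stages below α.ord. One further step then contains their coproduct. -/
theorem locAlpha_le_iSup_locAlphaStage {α : Cardinal.{w}} (hα : α.IsRegular)
    (P : ObjectProperty C) :
    LocAlpha α P ≤ ⨆ β : Set.Iio α.ord, locAlphaStage α P β.1 := by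
  set U := ⨆ β : Set.Iio α.ord, locAlphaStage α P β.1 with hU
  have hsucc {β : Ordinal.{w}} (hβ : β < α.ord) : Order.succ β < α.ord :=
    (isSuccLimit_ord hα.1).succ_lt hβ
  have mem_iff (X : C) : U X ↔ ∃ β < α.ord, locAlphaStage α P β X := by
    simp [hU]
  have step {Q : ObjectProperty C} {β : Ordinal.{w}} (hβ : β < α.ord)
      (hQ : ∀ X, Q X → ∃ γ ≤ β, locAlphaStage α P γ X) : ∃ R, Q ≤ R ∧ locAlphaStep α R ≤ U :=
    ⟨P ⊔ ⨆ γ : Set.Iio (Order.succ β), locAlphaStage α P γ.1, fun X hX => by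
      obtain ⟨γ, hγ, h⟩ := hQ X hX
      have := le_iSup (fun γ : Set.Iio (Order.succ β) => locAlphaStage α P γ.1)
        ⟨γ, Order.lt_succ_of_le hγ⟩
      exact Or.inr (this X h), fun X hX =>
        (mem_iff X).2 ⟨_, hsucc hβ, by rwa [locAlphaStage]⟩⟩
  have hzero : (0 : Ordinal) < α.ord := ord_pos.2 hα.pos
  have hPU : P ≤ U := fun X hX => (mem_iff X).2 ⟨0, hzero, by
    rw [locAlphaStage]
    exact Or.inl (Or.inl (Or.inl (ObjectProperty.le_retractClosure _ _ (Or.inl hX))))⟩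
  have hret : U.IsStableUnderRetracts := ⟨fun {X Y} r hY => by
    obtain ⟨β, hβ, h⟩ := (mem_iff Y).1 hY
    obtain ⟨R, hR, hR'⟩ := step (Q := locAlphaStage α P β) hβ fun X hX => ⟨β, le_rfl, hX⟩
    exact hR' _ (Or.inl (Or.inl (Or.inl ⟨Y, hR _ h, ⟨r⟩⟩)))⟩
  have hcop (J : Type w) (hJ : #J < α) : U.IsClosedUnderColimitsOfShape (Discrete J) := by
    refine isClosedUnderColimitsOfShape_discrete fun Y c hc h => ?_
    choose β hβ hY using fun j => (mem_iff _).1 (h j)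
    obtain ⟨R, hR, hR'⟩ := step (Q := ObjectProperty.ofObj Y)
      (iSup_lt_of_lt_cof (by rwa [hα.cof_ord]) hβ) (by
        rintro _ ⟨j⟩
        exact ⟨β j, Ordinal.le_iSup β j, hY j⟩)
    -- The steps add only coproducts indexed by subsets of `α.out`, so J is replaced by its image
    -- under an embedding.
    have hJ' : #J ≤ #α.out := by simpa using hJ.le
    obtain ⟨ι⟩ := Cardinal.le_def _ _ |>.1 hJ'
    refine hR' _ (Or.inr ?_)
    have : (R.colimitsClosure fun S : Set α.out => Discrete S).IsClosedUnderColimitsOfShape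
        (Discrete (Set.range ι)) :=
      inferInstanceAs (ObjectProperty.IsClosedUnderColimitsOfShape
        (R.colimitsClosure fun S : Set α.out => Discrete S)
        ((fun S : Set α.out => Discrete S) (Set.range ι)))
    have := ObjectProperty.IsClosedUnderColimitsOfShape.of_equivalence
      (P := R.colimitsClosure fun S : Set α.out => Discrete S)
      (Discrete.equivalence (Equiv.ofInjective ι ι.injective).symm)
    exact prop_cofan_pt _ hc fun j => ObjectProperty.le_colimitsClosure _ _ _ (hR _ ⟨j⟩)
  refine locAlpha_le ⟨?_, hret, hcop⟩ hPU
  exact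
  { exists_zero := ⟨_, isZero_zero C, by
      have := hcop PEmpty (by simpa using hα.pos)
      let c : Cofan (PEmpty.elim : PEmpty.{w + 1} → C) := Cofan.mk 0 (fun j => j.elim)
      have hc : IsColimit c := Cofan.IsColimit.mk _ (fun _ => 0) (fun _ j => j.elim)
        (fun _ _ _ => (isZero_zero C).eq_of_src _ _)
      exact prop_cofan_pt U hc fun j => j.elim⟩
    isStableUnderShiftBy := fun n => ⟨fun X hX => by
      obtain ⟨β, hβ, h⟩ := (mem_iff X).1 hX
      obtain ⟨R, hR, hR'⟩ := step (Q := locAlphaStage α P β) hβ fun X hX => ⟨β, le_rfl, hX⟩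
      refine hR' _ (Or.inl (Or.inr ?_))
      exact (le_iSup (fun n : ℤ => R.map (shiftFunctor C n)) n) _ (R.prop_map_obj _ (hR _ h))⟩
    toIsTriangulatedClosed₂ := .mk' fun T hT h₁ h₃ => by
      obtain ⟨β₁, hβ₁, h₁⟩ := (mem_iff _).1 h₁
      obtain ⟨β₃, hβ₃, h₃⟩ := (mem_iff _).1 h₃
      obtain ⟨R, hR, hR'⟩ := step (Q := locAlphaStage α P β₁ ⊔ locAlphaStage α P β₃)
        (max_lt hβ₁ hβ₃) (by
          rintro X (h | h)
          exacts [⟨_, le_max_left _ _, h⟩, ⟨_, le_max_right _ _, h⟩])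
      exact hR' _ (Or.inl (Or.inl (Or.inr
        ⟨_, _, _, _, _, hT, hR _ (Or.inl h₁), hR _ (Or.inr h₃)⟩))) }

theorem locAlpha_essentiallySmall [LocallySmall.{w} C] {α : Cardinal.{w}} (hα : α.IsRegular)
    (P : ObjectProperty C) [ObjectProperty.EssentiallySmall.{w} P] :
    ObjectProperty.EssentiallySmall.{w} (LocAlpha α P) := by
  have := fun β => locAlphaStage_essentiallySmall α P β
  exact .of_le (locAlpha_le_iSup_locAlphaStage hα P)

end EssentiallySmall

end WellGenerated

namespace WellGenerated

variable {C : Type u} [Category.{v} C] [HasZeroObject C] [HasShift C ℤ] [Preadditive C]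
  [∀ n : ℤ, (shiftFunctor C n).Additive] [Pretriangulated C]

/-! ### Factorization of morphisms from α-compact objects -/

section Factorization

theorem IsLocalizing.isAlphaLocalizing {P : ObjectProperty C} (hP : IsLocalizing.{w} P)
    (α : Cardinal.{w}) : IsAlphaLocalizing α P :=
  ⟨hP.1, hP.2, fun J _ => hP.3 J⟩

theorem locAlpha_le_loc (α : Cardinal.{w}) (G : ObjectProperty C) :
    LocAlpha α G ≤ Loc.{w} G :=
  locAlpha_le ((isLocalizing_loc G).isAlphaLocalizing α) (le_loc G)

/-- The objects `X` such that every morphism from an object of `P` to `X` factors through an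
object of `N`. -/
def FactorsThrough (P N : ObjectProperty C) : ObjectProperty C := fun X =>
  ∀ (A : C) (f : A ⟶ X), P A → ∃ (B : C) (a : A ⟶ B) (b : B ⟶ X), N B ∧ a ≫ b = f

theorem FactorsThrough.shift {P N : ObjectProperty C} [P.IsTriangulated] [N.IsTriangulated]
    {X : C} (hX : FactorsThrough P N X) (n : ℤ) : FactorsThrough P N (X⟦n⟧) := by
  intro A f hA
  let adj := (shiftEquiv C n).symm.toAdjunction
  obtain ⟨g, rfl⟩ := (adj.homEquiv _ _).surjective f
  obtain ⟨B, a, b, hB, rfl⟩ := hX _ g (P.le_shift (-n) _ hA)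
  exact ⟨B⟦n⟧, adj.homEquiv _ _ a, b⟦n⟧', N.le_shift n _ hB,
    (adj.homEquiv_naturality_right a b).symm⟩

/-- Factor f ≫ v through B in N. The obstruction to lifting B ⟶ X₃ to X₂ is a morphism from the cone
F of A ⟶ B to X₁⟦1⟧. As F lies in P, it factors through some E in N, and on the fibre Y of B ⟶ E the
obstruction vanishes. Then f differs from A ⟶ Y ⟶ X₂ by a morphism through X₁, hence through some B'
in N, and f factors through Y ⊞ B'. -/
theorem FactorsThrough.of_distTriang {P N : ObjectProperty C} [P.IsTriangulated]
    [P.IsClosedUnderIsomorphisms] [N.IsTriangulated] [N.IsClosedUnderIsomorphisms] (hN : N ≤ P)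
    {X₁ X₂ X₃ : C} {u : X₁ ⟶ X₂} {v : X₂ ⟶ X₃} {w' : X₃ ⟶ X₁⟦(1 : ℤ)⟧}
    (hT : Triangle.mk u v w' ∈ distTriang C) (h₁ : FactorsThrough P N X₁)
    (h₃ : FactorsThrough P N X₃) : FactorsThrough P N X₂ := by
  intro A f hA
  obtain ⟨B, a, b, hB, fac⟩ := h₃ A (f ≫ v) hA
  obtain ⟨F, p, q, hF⟩ := distinguished_cocone_triangle a
  obtain ⟨t, ht⟩ := exists_desc₂ hF (b ≫ w') (by
    rw [reassoc_of% fac, distTriang_comp₂₃ hT, comp_zero])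
  obtain ⟨E, a', b', hE, fac'⟩ := h₁.shift 1 F t
    (P.ext_of_isTriangulatedClosed₃ _ hF hA (hN _ hB))
  obtain ⟨Y, i, j, hY⟩ := distinguished_cocone_triangle₁ (p ≫ a')
  obtain ⟨c, hc⟩ : ∃ c : Y ⟶ X₂, i ≫ b = c ≫ v := by
    obtain ⟨c, hc, -⟩ := complete_distinguished_triangle_morphism₁ _ _ hY
      (rot_of_distTriang _ hT) b b' (by
        change (p ≫ a') ≫ b' = b ≫ w'
        rw [Category.assoc, fac', ht])
    exact ⟨c, hc⟩
  obtain ⟨l, hl⟩ := exists_lift₂ hY a (by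
    rw [reassoc_of% distTriang_comp₁₂ hF, zero_comp])
  obtain ⟨z, hz⟩ := exists_lift₂ hT (f - l ≫ c) (by
    rw [Preadditive.sub_comp, Category.assoc, ← hc, ← reassoc_of% hl, fac, sub_self])
  obtain ⟨B', a'', b'', hB', rfl⟩ := h₁ A z hA
  have hYN : N Y := N.ext_of_isTriangulatedClosed₁ _ hY hB hE
  refine ⟨Y ⊞ B', biprod.lift l a'', biprod.desc c (b'' ≫ u), ?_, ?_⟩
  · exact N.ext_of_isTriangulatedClosed₂ _ (binaryBiproductTriangle_distinguished Y B') hYN hB'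
  · rw [biprod.lift_desc, ← Category.assoc, ← hz]
    abel

/-- Decompose f and factor each D i ⟶ Y i through N; only the fewer than α indices in J contribute,
so the coproduct of the middle objects stays in N. -/
theorem FactorsThrough.cofan_pt [HasCoproducts.{w} C] {α : Cardinal.{w}}
    {P N : ObjectProperty C} (hP : P ≤ IsDecomposable α P) (hN : IsAlphaLocalizing α N)
    {I : Type w} {Y : I → C} {c : Cofan Y} (hc : IsColimit c) (h : ∀ i, FactorsThrough P N (Y i)) :
    FactorsThrough P N c.pt := by
  classical
  intro A f hA
  obtain ⟨J, D, k, d, hd, g, hJ, hD, hz, rfl⟩ := hP A hA I Y c hc f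
  choose B a b hB fac using fun i => h i (D i) (k i) (hD i)
  let B' (j : J) := B j
  let e := coproductIsCoproduct B'
  have := hN.closed_coproducts J hJ
  refine ⟨∐ B', g ≫ Cofan.IsColimit.desc hd fun i =>
    if h : i ∈ J then a i ≫ Sigma.ι B' ⟨i, h⟩ else 0,
    Cofan.IsColimit.desc e fun j => b j ≫ c.inj j, prop_cofan_pt N e fun j => hB j, ?_⟩
  rw [Category.assoc]
  congr 1
  refine Cofan.IsColimit.hom_ext hd _ _ fun i => ?_
  rw [← Category.assoc, Cofan.IsColimit.fac, Cofan.IsColimit.fac]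
  by_cases h : i ∈ J
  · have := Cofan.IsColimit.fac e (fun j => b j ≫ c.inj j) ⟨i, h⟩
    dsimp at this
    simp only [h, dif_pos, Category.assoc]
    rw [this, reassoc_of% fac]
  · exact (hz i h).eq_of_src _ _

theorem FactorsThrough.isLocalizing [HasCoproducts.{w} C] {α : Cardinal.{w}}
    {P N : ObjectProperty C} (hP : IsAlphaLocalizing α P) (hP' : P ≤ IsDecomposable α P)
    (hN : IsAlphaLocalizing α N) (hNP : N ≤ P) : IsLocalizing.{w} (FactorsThrough P N) := by
  have := hP.isTriangulated
  have := hP.isStableUnderRetracts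
  have := hN.isTriangulated
  have := hN.isStableUnderRetracts
  have hret : (FactorsThrough P N).IsStableUnderRetracts := ⟨fun r hY A f hA => by
    obtain ⟨B, a, b, hB, fac⟩ := hY A (f ≫ r.i) hA
    exact ⟨B, a, b ≫ r.r, hB, by rw [reassoc_of% fac, r.retract, Category.comp_id]⟩⟩
  exact
  { isTriangulated :=
    { exists_zero := ⟨_, isZero_zero C, fun A f _ =>
        ⟨_, 0, 0, N.prop_of_isZero (isZero_zero C), (isZero_zero C).eq_of_tgt _ _⟩⟩
      isStableUnderShiftBy := fun n => ⟨fun X hX => hX.shift n⟩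
      toIsTriangulatedClosed₂ := .mk' fun T hT h₁ h₃ => .of_distTriang hNP hT h₁ h₃ }
    isStableUnderRetracts := hret
    closed_coproducts := fun J => isClosedUnderColimitsOfShape_discrete fun Y c hc h =>
      FactorsThrough.cofan_pt hP' hN hc h }

/-- A morphism from an object of `P` to an object of the localizing subcategory generated by a
subclass `S` of `P` factors through the `α`-localizing subcategory generated by `S`. -/
theorem loc_le_factorsThrough [HasCoproducts.{w} C] {α : Cardinal.{w}} {P S : ObjectProperty C}
    (hP : IsAlphaLocalizing α P) (hP' : P ≤ IsDecomposable α P) (hS : S ≤ P) :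
    Loc.{w} S ≤ FactorsThrough P (LocAlpha α S) :=
  loc_le (FactorsThrough.isLocalizing hP hP' (isAlphaLocalizing_locAlpha α S)
    (locAlpha_le hP hS)) fun X hX _ f _ =>
      ⟨X, f, 𝟙 X, le_locAlpha α S X hX, Category.comp_id f⟩

/-- Factoring the identity of X makes X a retract of an object of `LocAlpha α S`. -/
theorem loc_inf_le_locAlpha [HasCoproducts.{w} C] {α : Cardinal.{w}} {P S : ObjectProperty C}
    (hP : IsAlphaLocalizing α P) (hP' : P ≤ IsDecomposable α P) (hS : S ≤ P) :
    Loc.{w} S ⊓ P ≤ LocAlpha α S := fun X hX => by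
  obtain ⟨B, a, b, hB, fac⟩ := loc_le_factorsThrough hP hP' hS X hX.1 X (𝟙 X) hX.2
  exact (LocAlpha α S).prop_of_retract ⟨a, b, fac⟩ hB

end Factorization

/-! ### Independence of generators and a criterion for well generation -/

section WellGenerated

theorem IsWellGeneratedBy.sup {α : Cardinal.{w}} {G H : ObjectProperty C}
    (hG : IsWellGeneratedBy α G) (hH : IsWellGeneratedBy α H) : IsWellGeneratedBy α (G ⊔ H) where
  locallySmall := hG.locallySmall
  hasCoproducts := hG.hasCoproducts
  small := by
    have := hG.small
    have := hH.small
    infer_instance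
  isAlphaSmall A hA := hA.elim (hG.isAlphaSmall A) (hH.isAlphaSmall A)
  generates P hP h := hG.generates P hP (le_sup_left.trans h)
  isPerfectClass I X Y φ c hc d hd h A hA := hA.elim
    (hG.isPerfectClass I X Y φ c hc d hd (fun A hA => h A (Or.inl hA)) A)
    (hH.isPerfectClass I X Y φ c hc d hd (fun A hA => h A (Or.inr hA)) A)

/-- The class of `α`-compact objects does not depend on the choice of generators. -/
theorem IsWellGeneratedBy.locAlpha_le_locAlpha {α : Cardinal.{w}} (hα : α.IsRegular)
    {G H : ObjectProperty C} (hG : IsWellGeneratedBy α G) (hH : IsWellGeneratedBy α H) :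
    LocAlpha α H ≤ LocAlpha α G := by
  have := hG.hasCoproducts
  refine locAlpha_le (isAlphaLocalizing_locAlpha α G) fun X hX => ?_
  -- Inside the α-compact objects for G ⊔ H, take G as the generating subclass: `Loc G` is
  -- everything, so X lies in `LocAlpha α G`.
  exact loc_inf_le_locAlpha (isAlphaLocalizing_locAlpha α (G ⊔ H))
    ((hG.sup hH).locAlpha_le_isDecomposable hα) (le_sup_left.trans (le_locAlpha α (G ⊔ H))) X
    ⟨hG.generates _ (isLocalizing_loc G) (le_loc G) X, le_locAlpha α (G ⊔ H) X (Or.inr hX)⟩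

theorem IsWellGeneratedBy.locAlpha_eq {α : Cardinal.{w}} (hα : α.IsRegular)
    {G H : ObjectProperty C} (hG : IsWellGeneratedBy α G) (hH : IsWellGeneratedBy α H) :
    LocAlpha α H = LocAlpha α G :=
  le_antisymm (hG.locAlpha_le_locAlpha hα hH) (hH.locAlpha_le_locAlpha hα hG)

/-- An essentially small generating class whose objects decompose into objects of the class
contains a small set of representatives by which the category is well generated. -/
theorem exists_isWellGeneratedBy {α : Cardinal.{w}} (hC : LocallySmall.{w} C)
    (hC' : HasCoproducts.{w} C) {P : ObjectProperty C} (hs : ObjectProperty.EssentiallySmall.{w} P)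
    (hP : P ≤ IsDecomposable α P)
    (hgen : ∀ Q : ObjectProperty C, IsLocalizing.{w} Q → P ≤ Q → ∀ X, Q X) :
    ∃ G : ObjectProperty C, G ≤ P ∧ P ≤ G.isoClosure ∧ IsWellGeneratedBy α G := by
  obtain ⟨G, hG, hGP, hPG⟩ := ObjectProperty.EssentiallySmall.exists_small_le.{w} P
  refine ⟨G, hGP, hPG, hC, hC', hG, fun A hA => (hP A (hGP A hA)).isAlphaSmall, fun Q hQ h => ?_,
    isPerfectClass_of_isDecomposable hPG (hGP.trans hP)⟩
  have := hQ.isStableUnderRetracts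
  exact hgen Q hQ (hPG.trans ((ObjectProperty.isoClosure_le_iff _ _).2 h))

end WellGenerated

end WellGenerated

namespace WellGenerated

/-! ### Inverse images and localizing subcategories of S -/

section InverseImage

theorem isStableUnderRetracts_inverseImage {C D : Type*} [Category* C] [Category* D]
    (F : C ⥤ D) {P : ObjectProperty D} (hP : P.IsStableUnderRetracts) :
    (P.inverseImage F).IsStableUnderRetracts :=
  ⟨fun r h => P.prop_of_retract (r.map F) h⟩

variable {C D : Type*} [Category* C] [HasZeroObject C] [HasShift C ℤ] [Preadditive C]
  [∀ n : ℤ, (shiftFunctor C n).Additive] [Pretriangulated C]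
  [Category* D] [HasZeroObject D] [HasShift D ℤ] [Preadditive D]
  [∀ n : ℤ, (shiftFunctor D n).Additive] [Pretriangulated D]
  (F : C ⥤ D) [F.CommShift ℤ] [F.IsTriangulated]
  [∀ J : Type w, PreservesColimitsOfShape (Discrete J) F]

theorem IsLocalizing.inverseImage {P : ObjectProperty D} (hP : IsLocalizing.{w} P) :
    IsLocalizing.{w} (P.inverseImage F) := by
  have := hP.isTriangulated
  have := hP.isStableUnderRetracts
  have := hP.closed_coproducts
  exact ⟨inferInstance, isStableUnderRetracts_inverseImage F inferInstance, fun J => inferInstance⟩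

theorem IsAlphaLocalizing.inverseImage {α : Cardinal.{w}} {P : ObjectProperty D}
    (hP : IsAlphaLocalizing α P) : IsAlphaLocalizing α (P.inverseImage F) := by
  have := hP.isTriangulated
  have := hP.isStableUnderRetracts
  refine ⟨inferInstance, isStableUnderRetracts_inverseImage F inferInstance, fun J hJ => ?_⟩
  have := hP.closed_coproducts J hJ
  infer_instance

end InverseImage

section Subcategory

variable {C : Type u} [Category.{v} C] [HasZeroObject C] [HasShift C ℤ] [Preadditive C]
  [∀ n : ℤ, (shiftFunctor C n).Additive] [Pretriangulated C]

theorem hasCoproducts_fullSubcategory {C : Type*} [Category* C] [HasCoproducts.{w} C]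
    {S : ObjectProperty C}
    (hS : ∀ J : Type w, S.IsClosedUnderColimitsOfShape (Discrete J)) :
    HasCoproducts.{w} S.FullSubcategory := fun J =>
  have := hS J
  hasColimitsOfShape_of_hasColimitsOfShape_createsColimitsOfShape S.ι

theorem preservesCoproducts_ι {C : Type*} [Category* C] [HasCoproducts.{w} C]
    {S : ObjectProperty C} (hS : ∀ J : Type w, S.IsClosedUnderColimitsOfShape (Discrete J))
    (J : Type w) : PreservesColimitsOfShape (Discrete J) S.ι :=
  have := hS J
  inferInstance

theorem essentiallySmall_inverseImage_ι {C : Type*} [Category* C] (S N : ObjectProperty C)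
    [S.IsClosedUnderIsomorphisms] [ObjectProperty.EssentiallySmall.{w} N] :
    ObjectProperty.EssentiallySmall.{w} (N.inverseImage S.ι) := by
  obtain ⟨N₀, _, -, h⟩ := ObjectProperty.EssentiallySmall.exists_small_le.{w} N
  refine ⟨N₀.inverseImage S.ι,
    small_of_injective (f := fun X => (⟨X.1.obj, X.2⟩ : Subtype N₀)) fun X Y h => ?_,
    fun X hX => ?_⟩
  · obtain ⟨⟨X, _⟩, _⟩ := X
    obtain ⟨⟨Y, _⟩, _⟩ := Y
    obtain rfl : X = Y := congrArg Subtype.val h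
    rfl
  · obtain ⟨Y, hY, ⟨e⟩⟩ := h _ hX
    exact ⟨⟨Y, S.prop_of_iso e X.property⟩, hY, ⟨S.fullyFaithfulι.preimageIso e⟩⟩

/-- The objects of a localizing subcategory `S` that belong to `N` decompose within `S` if
`N` is contained in a class `P` of decomposable objects and morphisms from `P` to `S` factor
through `N`. -/
theorem inverseImage_ι_le_isDecomposable [HasCoproducts.{w} C] {α : Cardinal.{w}}
    {S P N : ObjectProperty C} (hS : IsLocalizing.{w} S) [N.ContainsZero]
    [N.IsClosedUnderIsomorphisms] (hP : P ≤ IsDecomposable α P) (hNP : N ≤ P) (hNS : N ≤ S)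
    (hfac : S ≤ FactorsThrough P N) :
    N.inverseImage S.ι ≤ IsDecomposable α (N.inverseImage S.ι) := by
  classical
  have := hasCoproducts_fullSubcategory hS.closed_coproducts
  have := preservesCoproducts_ι hS.closed_coproducts
  intro A hA I Y c hc f
  obtain ⟨J, D, k, d, hd, g, hJ, hD, hz, fac⟩ :=
    hP _ (hNP _ hA) I _ _ (isColimitMapCofan S.ι hc) f.hom
  -- Outside J the factorization is taken through zero, so that fewer than α of the new pieces are
  -- nonzero.
  have h (i : I) : ∃ (B : C) (a : D i ⟶ B) (b : B ⟶ (Y i).obj), N B ∧ a ≫ b = k i ∧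
      (i ∉ J → IsZero B) := by
    by_cases hi : i ∈ J
    · obtain ⟨B, a, b, hB, h⟩ := hfac _ (Y i).property (D i) (k i) (hD i)
      exact ⟨B, a, b, hB, h, fun h => (h hi).elim⟩
    · exact ⟨_, 0, 0, N.prop_of_isZero (isZero_zero C), (hz i hi).eq_of_src _ _,
        fun _ => isZero_zero C⟩
  choose B a b hB hab hBz using h
  let E (i : I) : S.FullSubcategory := ⟨B i, hNS _ (hB i)⟩
  have hE := coproductIsCoproduct E
  refine ⟨J, E, fun i => S.homMk (b i), _, hE, S.homMk (g ≫ Cofan.IsColimit.desc hd fun i =>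
    a i ≫ (Sigma.ι E i).hom), hJ, hB, fun i hi => ?_, ?_⟩
  · rw [IsZero.iff_id_eq_zero]
    ext
    exact (hBz i hi).eq_of_src _ _
  · ext
    rw [← fac]
    change (g ≫ _) ≫ _ = _
    rw [Category.assoc]
    congr 1
    refine Cofan.IsColimit.hom_ext hd _ _ fun i => ?_
    have h := congrArg (fun φ => φ.hom)
      (Cofan.IsColimit.fac hE (fun i => S.homMk (b i) ≫ c.inj i) i)
    change (Sigma.ι E i).hom ≫ _ = b i ≫ (c.inj i).hom at h
    rw [← Category.assoc, Cofan.IsColimit.fac, Cofan.IsColimit.fac, Category.assoc, h,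
      reassoc_of% hab]
    rfl

/-- This reduces (PG1) for S = Loc S₀ to the minimality of Loc S₀ in the ambient category. -/
theorem IsLocalizing.map_ι [HasCoproducts.{w} C] {S : ObjectProperty C} [S.IsTriangulated]
    (hS : IsLocalizing.{w} S) {Q : ObjectProperty S.FullSubcategory} (hQ : IsLocalizing.{w} Q) :
    IsLocalizing.{w} (Q.map S.ι) := by
  have := hS.isStableUnderRetracts
  have := hQ.isTriangulated
  have := hQ.isStableUnderRetracts
  have := hasCoproducts_fullSubcategory hS.closed_coproducts
  have := preservesCoproducts_ι hS.closed_coproducts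
  refine ⟨inferInstance, ⟨?_⟩, fun J => isClosedUnderColimitsOfShape_discrete fun Y c hc h => ?_⟩
  · rintro X Y r ⟨Z, hZ, ⟨e⟩⟩
    have r' : Retract X Z.obj := r.trans (Retract.ofIso e.symm)
    have r'' : Retract (⟨X, S.prop_of_retract r' Z.property⟩ : S.FullSubcategory) Z :=
      ⟨S.homMk r'.i, S.homMk r'.r, by ext; exact r'.retract⟩
    exact ⟨_, Q.prop_of_retract r'' hZ, ⟨Iso.refl X⟩⟩
  · choose Z hZ e using h
    have := hQ.closed_coproducts J
    have hz := coproductIsCoproduct Z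
    exact ⟨_, prop_cofan_pt Q hz hZ, ⟨IsColimit.coconePointUniqueUpToIso
      (isColimitMapCofan S.ι hz) (isColimitIsoCofan (fun j => (e j).some) hc)⟩⟩

/-- A localizing subcategory generated by `α`-compact objects is `α`-well generated. -/
theorem exists_isWellGeneratedBy_loc [LocallySmall.{w} C] [HasCoproducts.{w} C]
    {α : Cardinal.{w}} {P S₀ : ObjectProperty C} (hP : IsAlphaLocalizing α P)
    [ObjectProperty.EssentiallySmall.{w} P]
    (hP' : P ≤ IsDecomposable α P) (hS : S₀ ≤ P) :
    ∃ H : ObjectProperty (Loc.{w} S₀).FullSubcategory,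
      H ≤ (LocAlpha α S₀).inverseImage (Loc.{w} S₀).ι ∧
      (LocAlpha α S₀).inverseImage (Loc.{w} S₀).ι ≤ H.isoClosure ∧ IsWellGeneratedBy α H := by
  have hN : ObjectProperty.EssentiallySmall.{w} (LocAlpha α S₀) := .of_le (locAlpha_le hP hS)
  have hloc := isLocalizing_loc.{w} S₀
  refine exists_isWellGeneratedBy inferInstance
    (hasCoproducts_fullSubcategory hloc.closed_coproducts) (essentiallySmall_inverseImage_ι _ _)
    (inverseImage_ι_le_isDecomposable hloc hP' (locAlpha_le hP hS) (locAlpha_le_loc α S₀)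
      (loc_le_factorsThrough hP hP' hS)) fun Q hQ hNQ X => ?_
  have := hQ.isStableUnderRetracts
  obtain ⟨Y, hY, ⟨e⟩⟩ := loc_le (hloc.map_ι hQ) (fun Z hZ => ⟨⟨Z, le_loc S₀ Z hZ⟩,
    hNQ _ (le_locAlpha α S₀ Z hZ), ⟨Iso.refl Z⟩⟩) X.obj X.property
  exact Q.prop_of_iso ((Loc.{w} S₀).fullyFaithfulι.preimageIso e) hY

theorem locAlpha_eq_inverseImage_ι [LocallySmall.{w} C] [HasCoproducts.{w} C]
    {α : Cardinal.{w}} (hα : α.IsRegular) {P S₀ : ObjectProperty C} (hP : IsAlphaLocalizing α P)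
    [ObjectProperty.EssentiallySmall.{w} P] (hP' : P ≤ IsDecomposable α P) (hS : S₀ ≤ P)
    {H : ObjectProperty (Loc.{w} S₀).FullSubcategory} (hH : IsWellGeneratedBy α H) :
    LocAlpha α H = P.inverseImage (Loc.{w} S₀).ι := by
  obtain ⟨H', hH', hH'', hw⟩ := exists_isWellGeneratedBy_loc hP hP' hS
  have := preservesCoproducts_ι (isLocalizing_loc.{w} S₀).closed_coproducts
  rw [hw.locAlpha_eq hα hH]
  refine le_antisymm (locAlpha_le (hP.inverseImage _) fun X hX =>
    locAlpha_le hP hS _ (hH' X hX)) fun X hX => ?_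
  exact (ObjectProperty.isoClosure_le_iff _ _).2 (le_locAlpha α H') X
    (hH'' X (loc_inf_le_locAlpha hP hP' hS _ ⟨X.property, hX⟩))

end Subcategory

end WellGenerated

namespace WellGenerated

/-! ### Coproducts in the Verdier quotient -/

section Quotient

open ZeroObject

variable {C : Type u} [Category.{v} C] [HasZeroObject C] [HasShift C ℤ] [Preadditive C]
  [∀ n : ℤ, (shiftFunctor C n).Additive] [Pretriangulated C]

theorem trW_desc [HasCoproducts.{w} C] {S : ObjectProperty C} {I : Type w}
    [S.IsClosedUnderColimitsOfShape (Discrete I)] {X Y : I → C} {s : ∀ i, X i ⟶ Y i}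
    (hs : ∀ i, S.trW (s i)) {c : Cofan X} (hc : IsColimit c) {d : Cofan Y} (hd : IsColimit d) :
    S.trW (Cofan.IsColimit.desc hc fun i => s i ≫ d.inj i) := by
  choose Z g h hT hZ using hs
  have hz := coproductIsCoproduct Z
  exact ⟨_, _, _, exists_cofan_triangle s g h hT hc hd hz, prop_cofan_pt S hz hZ⟩

variable [IsTriangulated C]

/-- A morphism is annihilated by the quotient functor if and only if it factors through an object
of the subcategory. -/
theorem map_Q_eq_zero_iff (S : ObjectProperty C) [S.IsTriangulated] {X Y : C}
    (f : X ⟶ Y) : S.trW.Q.map f = 0 ↔ ∃ (Z : C) (a : X ⟶ Z) (b : Z ⟶ Y), S Z ∧ a ≫ b = f := by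
  constructor
  · intro h
    rw [← Functor.map_zero, MorphismProperty.map_eq_iff_postcomp S.trW.Q S.trW] at h
    obtain ⟨W, t, ht, h⟩ := h
    rw [S.trW_iff'] at ht
    obtain ⟨Z, b, c, hT, hZ⟩ := ht
    obtain ⟨a, ha⟩ := exists_lift₂ hT f (by rw [h, zero_comp])
    exact ⟨Z, a, b, hZ, ha.symm⟩
  · rintro ⟨Z, a, b, hZ, rfl⟩
    have : S.trW (0 : Z ⟶ 0) := by
      rw [S.trW_iff']
      exact ⟨_, _, _, contractible_distinguished Z, hZ⟩
    have := Localization.inverts S.trW.Q S.trW _ this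
    have hz : IsZero (S.trW.Q.obj Z) :=
      (S.trW.Q.map_isZero (isZero_zero C)).of_iso (asIso (S.trW.Q.map (0 : Z ⟶ 0)))
    rw [Functor.map_comp, hz.eq_of_tgt (S.trW.Q.map a) 0, zero_comp]

/-- Write each f i as a right fraction. The coproduct of the denominators is again a denominator,
its cone being a coproduct of objects of S. -/
theorem exists_Q_desc [HasCoproducts.{w} C] {S : ObjectProperty C} [S.IsTriangulated]
    {I : Type w} [S.IsClosedUnderColimitsOfShape (Discrete I)] {Y : I → C} {c : Cofan Y}
    (hc : IsColimit c) {Z : C} (f : ∀ i, S.trW.Q.obj (Y i) ⟶ S.trW.Q.obj Z) :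
    ∃ h : S.trW.Q.obj c.pt ⟶ S.trW.Q.obj Z, ∀ i, S.trW.Q.map (c.inj i) ≫ h = f i := by
  choose φ hφ using fun i => Localization.exists_rightFraction S.trW.Q S.trW (f i)
  have hd := coproductIsCoproduct fun i => (φ i).X'
  let s := Cofan.IsColimit.desc hd fun i => (φ i).s ≫ c.inj i
  have hs : S.trW s := trW_desc (fun i => (φ i).hs) hd hc
  have := Localization.inverts S.trW.Q S.trW _ hs
  refine ⟨inv (S.trW.Q.map s) ≫ S.trW.Q.map (Cofan.IsColimit.desc hd fun i => (φ i).f),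
    fun i => ?_⟩
  have := Localization.inverts S.trW.Q S.trW _ (φ i).hs
  rw [← cancel_epi (S.trW.Q.map (φ i).s), hφ, MorphismProperty.RightFraction.map_s_comp_map,
    ← Functor.map_comp_assoc, ← Cofan.IsColimit.fac hd (fun i => (φ i).s ≫ c.inj i) i,
    Functor.map_comp_assoc, IsIso.hom_inv_id_assoc, ← Functor.map_comp, Cofan.IsColimit.fac]

/-- Up to a denominator, f - g comes from a morphism of C. Its restrictions to the Y i factor
through objects B i of S, so it factors through ∐ B i, which lies in S. -/
theorem Q_hom_ext [HasCoproducts.{w} C] {S : ObjectProperty C} [S.IsTriangulated]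
    {I : Type w} [S.IsClosedUnderColimitsOfShape (Discrete I)] {Y : I → C} {c : Cofan Y}
    (hc : IsColimit c) {Z : C} {f g : S.trW.Q.obj c.pt ⟶ S.trW.Q.obj Z}
    (h : ∀ i, S.trW.Q.map (c.inj i) ≫ f = S.trW.Q.map (c.inj i) ≫ g) : f = g := by
  obtain ⟨φ, hφ⟩ := Localization.exists_leftFraction S.trW.Q S.trW (f - g)
  have := Localization.inverts S.trW.Q S.trW _ φ.hs
  have hφ' : S.trW.Q.map φ.f = (f - g) ≫ S.trW.Q.map φ.s := by
    rw [hφ, MorphismProperty.LeftFraction.map_comp_map_s]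
  have hz (i : I) : S.trW.Q.map (c.inj i ≫ φ.f) = 0 := by
    rw [Functor.map_comp, hφ', ← Category.assoc, Preadditive.comp_sub, h, sub_self, zero_comp]
  choose B a b hB hab using fun i => (map_Q_eq_zero_iff S _).1 (hz i)
  have hd := coproductIsCoproduct B
  have : S.trW.Q.map φ.f = 0 := (map_Q_eq_zero_iff S _).2
    ⟨_, Cofan.IsColimit.desc hc fun i => a i ≫ Sigma.ι B i, Cofan.IsColimit.desc hd b,
      prop_cofan_pt S hd hB, Cofan.IsColimit.hom_ext hc _ _ fun i => by
        have := Cofan.IsColimit.fac hd b i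
        dsimp at this
        rw [← Category.assoc, Cofan.IsColimit.fac, Category.assoc, this, hab]⟩
  rw [← sub_eq_zero, ← cancel_mono (S.trW.Q.map φ.s), ← hφ', this, zero_comp]

theorem preservesCoproducts_Q [HasCoproducts.{w} C] {S : ObjectProperty C} [S.IsTriangulated]
    (hS : ∀ J : Type w, S.IsClosedUnderColimitsOfShape (Discrete J)) (J : Type w) :
    PreservesColimitsOfShape (Discrete J) S.trW.Q := by
  have := hS J
  have := Localization.essSurj S.trW.Q S.trW
  have key (Y : J → C) : Nonempty (IsColimit (mapCofan S.trW.Q (Cofan.mk _ (Sigma.ι Y)))) := by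
    have hc := coproductIsCoproduct Y
    choose δ hδ using fun t : Cofan fun j => S.trW.Q.obj (Y j) => exists_Q_desc hc
      fun j => t.inj j ≫ (S.trW.Q.objObjPreimageIso t.pt).inv
    refine ⟨Cofan.IsColimit.mk _ (fun t => δ t ≫ (S.trW.Q.objObjPreimageIso t.pt).hom)
      (fun t j => ?_) fun t m hm => ?_⟩
    · have := hδ t j
      dsimp at this ⊢
      rw [reassoc_of% this, Iso.inv_hom_id, Category.comp_id]
    · rw [← Iso.comp_inv_eq]
      refine Q_hom_ext hc fun j => ?_
      rw [hδ, ← hm j, Category.assoc]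
      rfl
  have (Y : J → C) : PreservesColimit (Discrete.functor Y) S.trW.Q :=
    preservesColimit_of_preserves_colimit_cocone (coproductIsCoproduct Y)
      ((Cofan.isColimitMapCoconeEquiv S.trW.Q Y _).symm (key Y).some)
  exact preservesColimitsOfShape_of_discrete _

theorem hasCoproducts_quotient [HasCoproducts.{w} C] {S : ObjectProperty C} [S.IsTriangulated]
    (hS : ∀ J : Type w, S.IsClosedUnderColimitsOfShape (Discrete J)) :
    HasCoproducts.{w} S.trW.Localization := by
  have := preservesCoproducts_Q hS
  have := Localization.essSurj S.trW.Q S.trW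
  let e {J : Type w} (Y : J → S.trW.Localization) (j : J) := (S.trW.Q.objObjPreimageIso (Y j)).symm
  exact hasCoproducts_of_colimit_cofans (fun Y => isoCofan (e Y)
    (mapCofan S.trW.Q (Cofan.mk _ (Sigma.ι fun j => S.trW.Q.objPreimage (Y j)))))
    fun Y => isColimitIsoCofan (e Y) (isColimitMapCofan S.trW.Q (coproductIsCoproduct _))

end Quotient

/-! ### Smallness of morphism sets -/

section LocallySmall

variable {D : Type u} [Category.{v} D] [HasZeroObject D] [HasShift D ℤ] [Preadditive D]
  [∀ n : ℤ, (shiftFunctor D n).Additive] [Pretriangulated D]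

/-- A morphism X₂ ⟶ Y is a chosen representative of its restriction to X₁ plus a morphism through
X₃. -/
theorem small_hom_of_distTriang {X₁ X₂ X₃ : D} {u : X₁ ⟶ X₂} {v : X₂ ⟶ X₃}
    {w' : X₃ ⟶ X₁⟦(1 : ℤ)⟧} (hT : Triangle.mk u v w' ∈ distTriang D) (Y : D)
    [Small.{w} (X₁ ⟶ Y)] [Small.{w} (X₃ ⟶ Y)] : Small.{w} (X₂ ⟶ Y) := by
  let R := Set.range fun f : X₂ ⟶ Y => u ≫ f
  choose σ hσ using fun r : R => r.2
  refine small_of_surjective (f := fun p : R × (X₃ ⟶ Y) => σ p.1 + v ≫ p.2) fun f => ?_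
  let r : R := ⟨_, f, rfl⟩
  obtain ⟨t, ht⟩ := exists_desc₂ hT (f - σ r) (by
    rw [Preadditive.comp_sub, sub_eq_zero]
    exact (hσ r).symm)
  exact ⟨⟨r, t⟩, by dsimp only; rw [← ht]; abel⟩

/-- The objects `X` such that `Hom(X, Y)` is small for all `Y` form a localizing subcategory. -/
theorem isLocalizing_small_hom : IsLocalizing.{w} fun X : D => ∀ Y : D, Small.{w} (X ⟶ Y) := by
  have hret : ObjectProperty.IsStableUnderRetracts fun X : D => ∀ Y : D, Small.{w} (X ⟶ Y) :=
    ⟨fun {X X'} r h Y => by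
      have := h Y
      exact small_of_injective (f := fun f : X ⟶ Y => r.r ≫ f) fun f g h => by
        rw [← r.retract_assoc f, ← r.retract_assoc g]
        exact congrArg (r.i ≫ ·) h⟩
  exact
  { isTriangulated :=
    { exists_zero := ⟨_, isZero_zero D, fun Y =>
        small_of_injective (f := fun _ => PUnit.unit) fun _ _ _ => (isZero_zero D).eq_of_src _ _⟩
      isStableUnderShiftBy := fun n => ⟨fun X hX Y =>
        have := hX (Y⟦-n⟧)
        small_map ((shiftEquiv D n).toAdjunction.homEquiv X Y)⟩
      toIsTriangulatedClosed₂ := .mk' fun T hT h₁ h₃ Y =>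
        have := h₁ Y
        have := h₃ Y
        small_hom_of_distTriang hT Y }
    isStableUnderRetracts := hret
    closed_coproducts := fun J => isClosedUnderColimitsOfShape_discrete fun X c hc h Y =>
      have := fun j => h j Y
      small_of_injective (f := fun (f : c.pt ⟶ Y) j => c.inj j ≫ f) fun f g h =>
        Cofan.IsColimit.hom_ext hc _ _ fun j => congrFun h j }

end LocallySmall

end WellGenerated

namespace WellGenerated

/-! ### Well generation of the quotient and detection of S -/

section Quotient

variable {C : Type u} [Category.{v} C] [HasZeroObject C] [HasShift C ℤ] [Preadditive C]
  [∀ n : ℤ, (shiftFunctor C n).Additive] [Pretriangulated C] [IsTriangulated C]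

section

variable {P S : ObjectProperty C} [P.IsTriangulated]
  [S.IsTriangulated] [S.IsClosedUnderIsomorphisms] [P.IsVerdierLeftLocalizing S]

/-- By Verdier's condition, a denominator with target in P is dominated by one whose source also
lies in P. -/
theorem exists_Q_fraction {A Z : C} (hA : P A) (h : S.trW.Q.obj A ⟶ S.trW.Q.obj Z) :
    ∃ (B : C) (s : B ⟶ A) (f : B ⟶ Z), P B ∧ S.trW s ∧ S.trW.Q.map s ≫ h = S.trW.Q.map f := by
  obtain ⟨φ, hφ⟩ := Localization.exists_rightFraction S.trW.Q S.trW h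
  obtain ⟨B, s, a, hB, hs, fac⟩ := ObjectProperty.IsVerdierLeftLocalizing.fac' φ.s hA φ.hs
  refine ⟨B, s, a ≫ φ.f, hB, ObjectProperty.trW_monotone inf_le_right _ hs, ?_⟩
  rw [← fac, hφ, Functor.map_comp_assoc, MorphismProperty.RightFraction.map_s_comp_map,
    Functor.map_comp]

theorem small_Q_hom [LocallySmall.{w} C] [ObjectProperty.EssentiallySmall.{w} P] {A : C}
    (hA : P A) (Z : C) : Small.{w} (S.trW.Q.obj A ⟶ S.trW.Q.obj Z) := by
  obtain ⟨P₀, _, -, hP₀⟩ := ObjectProperty.EssentiallySmall.exists_small_le.{w} P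
  let K := Σ B : Subtype P₀, {s : B.1 ⟶ A // S.trW s} × (B.1 ⟶ Z)
  refine small_of_surjective (f := fun κ : K =>
    (Localization.isoOfHom S.trW.Q S.trW κ.2.1.1 κ.2.1.2).inv ≫ S.trW.Q.map κ.2.2) fun h => ?_
  obtain ⟨B, s, f, hB, hs, fac⟩ := exists_Q_fraction hA h
  obtain ⟨B₀, hB₀, ⟨ε⟩⟩ := hP₀ _ hB
  refine ⟨⟨⟨B₀, hB₀⟩, ⟨ε.inv ≫ s, S.trW.cancel_left_of_respectsIso ε.inv s |>.2 hs⟩,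
    ε.inv ≫ f⟩, ?_⟩
  rw [Iso.inv_comp_eq, Localization.isoOfHom_hom, Functor.map_comp, Functor.map_comp_assoc, fac]

theorem locallySmall_quotient [LocallySmall.{w} C] [HasCoproducts.{w} C]
    [ObjectProperty.EssentiallySmall.{w} P] (hS : IsLocalizing.{w} S)
    (hgen : ∀ R : ObjectProperty C, IsLocalizing.{w} R → P ≤ R → ∀ X, R X) :
    LocallySmall.{w} S.trW.Localization := by
  have := preservesCoproducts_Q hS.closed_coproducts
  have := Localization.essSurj S.trW.Q S.trW
  have hR := isLocalizing_small_hom.{w} (D := S.trW.Localization)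
  have := hR.isStableUnderRetracts
  refine ⟨fun X Y => ?_⟩
  refine ObjectProperty.prop_of_iso
    (fun X : S.trW.Localization => ∀ Y : S.trW.Localization, Small.{w} (X ⟶ Y))
    (S.trW.Q.objObjPreimageIso X) (hgen _ (hR.inverseImage S.trW.Q) (fun A hA Y => ?_) (S.trW.Q.objPreimage X)) Y
  have := small_Q_hom.{w} (S := S) hA (S.trW.Q.objPreimage Y)
  exact small_map ((S.trW.Q.objObjPreimageIso Y).homToEquiv (Z := S.trW.Q.obj A)).symm

/-- After lifting the Y i to C, a fraction replaces f by a morphism g of C from an object B of P to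
a coproduct. Decompose g in C and apply the quotient functor. -/
theorem map_Q_le_isDecomposable [HasCoproducts.{w} C] {α : Cardinal.{w}}
    (hS : IsLocalizing.{w} S) (hP : P ≤ IsDecomposable α P) :
    P.map S.trW.Q ≤ IsDecomposable α (P.map S.trW.Q) := by
  have := preservesCoproducts_Q hS.closed_coproducts
  have := Localization.essSurj S.trW.Q S.trW
  rintro A₀ ⟨A, hA, ⟨ε⟩⟩
  refine ObjectProperty.prop_of_iso _ ε ?_
  intro I Y c hc f
  let η i := S.trW.Q.objObjPreimageIso (Y i)
  have hz := coproductIsCoproduct fun i => S.trW.Q.objPreimage (Y i)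
  let δ := IsColimit.coconePointUniqueUpToIso (isColimitIsoCofan η hc)
    (isColimitMapCofan S.trW.Q hz)
  have hδ (i : I) : S.trW.Q.map (Sigma.ι (fun i => S.trW.Q.objPreimage (Y i)) i) ≫ δ.inv =
      (η i).hom ≫ c.inj i :=
    IsColimit.comp_coconePointUniqueUpToIso_inv (isColimitIsoCofan η hc)
      (isColimitMapCofan S.trW.Q hz) ⟨i⟩
  obtain ⟨B, s, g, hB, hs, fac⟩ := exists_Q_fraction hA (f ≫ δ.hom)
  obtain ⟨J, D, k, d, hd, g', hJ, hD, hzD, rfl⟩ := hP B hB I _ _ hz g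
  have := Localization.inverts S.trW.Q S.trW _ hs
  refine ⟨J, fun i => S.trW.Q.obj (D i), fun i => S.trW.Q.map (k i) ≫ (η i).hom, _,
    isColimitMapCofan S.trW.Q hd, inv (S.trW.Q.map s) ≫ S.trW.Q.map g', hJ,
    fun i => P.prop_map_obj _ (hD i), fun i hi => S.trW.Q.map_isZero (hzD i hi), ?_⟩
  rw [Category.assoc, IsIso.inv_comp_eq, ← cancel_mono δ.hom, Category.assoc, Category.assoc,
    fac, Functor.map_comp]
  congr 1
  rw [← Iso.eq_comp_inv]
  refine Cofan.IsColimit.hom_ext (isColimitMapCofan S.trW.Q hd) _ _ fun i => ?_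
  rw [Cofan.IsColimit.fac]
  change _ = S.trW.Q.map (d.inj i) ≫ _
  rw [← Functor.map_comp_assoc, Cofan.IsColimit.fac, Functor.map_comp_assoc, Category.assoc]
  exact congrArg _ (hδ i).symm

theorem exists_isWellGeneratedBy_quotient [LocallySmall.{w} C] [HasCoproducts.{w} C]
    {α : Cardinal.{w}} [ObjectProperty.EssentiallySmall.{w} P] (hS : IsLocalizing.{w} S)
    (hP : P ≤ IsDecomposable α P)
    (hgen : ∀ R : ObjectProperty C, IsLocalizing.{w} R → P ≤ R → ∀ X, R X) :
    ∃ H : ObjectProperty S.trW.Localization, H ≤ P.map S.trW.Q ∧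
      P.map S.trW.Q ≤ H.isoClosure ∧ IsWellGeneratedBy α H := by
  have := preservesCoproducts_Q hS.closed_coproducts
  have := Localization.essSurj S.trW.Q S.trW
  refine exists_isWellGeneratedBy (locallySmall_quotient hS hgen)
    (hasCoproducts_quotient hS.closed_coproducts) inferInstance (map_Q_le_isDecomposable hS hP)
    fun R hR h X => ?_
  have := hR.isStableUnderRetracts
  exact R.prop_of_iso (S.trW.Q.objObjPreimageIso X) (hgen _ (hR.inverseImage S.trW.Q)
    (fun A hA => h _ (P.prop_map_obj _ hA)) _)

/-- A test for W = 0: if this localizing subcategory contains generators, it contains W, whose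
identity then vanishes. All shifts of W are needed for closure under shifts. -/
theorem isLocalizing_hom_eq_zero {D : Type*} [Category* D] [HasZeroObject D] [HasShift D ℤ]
    [Preadditive D] [∀ n : ℤ, (shiftFunctor D n).Additive] [Pretriangulated D] (W : D) :
    IsLocalizing.{w} fun Y : D => ∀ (n : ℤ) (g : Y ⟶ W⟦n⟧), g = 0 := by
  have hret : ObjectProperty.IsStableUnderRetracts
      fun Y : D => ∀ (n : ℤ) (g : Y ⟶ W⟦n⟧), g = 0 :=
    ⟨fun r h n g => by rw [← r.retract_assoc g, h n (r.r ≫ g), comp_zero]⟩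
  exact
  { isTriangulated :=
    { exists_zero := ⟨_, isZero_zero D, fun n g => (isZero_zero D).eq_of_src _ _⟩
      isStableUnderShiftBy := fun m => ⟨fun Y hY n g => by
        let adj := (shiftEquiv D m).toAdjunction
        have h := hY _ (adj.homEquiv _ _ g ≫
          (shiftFunctorAdd' D n (-m) (n + -m) rfl).inv.app W)
        have h' : adj.homEquiv _ _ g = 0 := (cancel_mono
          ((shiftFunctorAdd' D n (-m) (n + -m) rfl).inv.app W)).1 (h.trans zero_comp.symm)
        rw [← (adj.homEquiv _ _).symm_apply_apply g, h', Adjunction.homEquiv_counit]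
        exact (congrArg (· ≫ _) (Functor.map_zero _ _ _)).trans zero_comp⟩
      toIsTriangulatedClosed₂ := .mk' fun T hT h₁ h₃ n g => by
        obtain ⟨t, rfl⟩ := exists_desc₂ hT g (h₁ n _)
        rw [h₃ n t, comp_zero] }
    isStableUnderRetracts := hret
    closed_coproducts := fun J => isClosedUnderColimitsOfShape_discrete fun Y c hc h n g =>
      Cofan.IsColimit.hom_ext hc _ _ fun j => by
        rw [h j n (c.inj j ≫ g), comp_zero] }

/-- If `P` generates, then `S` consists of the objects `X` such that all morphisms from `P` to `X`
factor through `P ∩ S`. -/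
theorem FactorsThrough.prop [HasCoproducts.{w} C] (hS : IsLocalizing.{w} S)
    (hgen : ∀ R : ObjectProperty C, IsLocalizing.{w} R → P ≤ R → ∀ X, R X) {X : C}
    (hX : FactorsThrough P (S ⊓ P) X) : S X := by
  have := preservesCoproducts_Q hS.closed_coproducts
  have := hS.isStableUnderRetracts
  -- A morphism from the image of P to a shift of X is a fraction with numerator B ⟶ X⟦n⟧ and B in
  -- P; the numerator factors through S, so the fraction is zero.
  have h := hgen _ ((isLocalizing_hom_eq_zero (S.trW.Q.obj X)).inverseImage S.trW.Q)
    (fun A hA n g => by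
      let ε := (S.trW.Q.commShiftIso n).app X
      obtain ⟨B, s, f, hB, hs, fac⟩ := exists_Q_fraction hA (g ≫ ε.inv)
      obtain ⟨E, a, b, hE, hf⟩ := hX.shift n B f hB
      have := Localization.inverts S.trW.Q S.trW _ hs
      rwa [(map_Q_eq_zero_iff S f).2 ⟨E, a, b, hE.1, hf⟩, Preadditive.IsIso.comp_left_eq_zero,
        Preadditive.IsIso.comp_right_eq_zero] at fac) X
  have hid : S.trW.Q.map (𝟙 X) = 0 := by
    have := h 0 ((shiftFunctorZero S.trW.Localization ℤ).inv.app (S.trW.Q.obj X))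
    rw [CategoryTheory.Functor.map_id, ← Preadditive.IsIso.comp_right_eq_zero _
      ((shiftFunctorZero S.trW.Localization ℤ).inv.app (S.trW.Q.obj X))]
    exact (Category.id_comp _).trans this
  obtain ⟨Z, a, b, hZ, hab⟩ := (map_Q_eq_zero_iff S _).1 hid
  exact S.prop_of_retract ⟨a, b, hab⟩ hZ

end

end Quotient

/-! ### Retract closures and splitting of idempotents -/

section RetractClosure

variable {C : Type u} [Category.{v} C] [HasZeroObject C] [HasShift C ℤ] [Preadditive C]
  [∀ n : ℤ, (shiftFunctor C n).Additive] [Pretriangulated C]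

theorem isAlphaLocalizing_retractClosure [HasCoproducts.{w} C] {α : Cardinal.{w}}
    (P : ObjectProperty C) [P.IsTriangulated] [P.IsClosedUnderIsomorphisms]
    (hP : ∀ J : Type w, Cardinal.mk J < α → P.IsClosedUnderColimitsOfShape (Discrete J)) :
    IsAlphaLocalizing α P.retractClosure where
  isTriangulated :=
    { exists_zero := ⟨_, isZero_zero C,
        P.le_retractClosure _ (P.prop_of_isZero (isZero_zero C))⟩
      isStableUnderShiftBy := fun n => ⟨fun X ⟨Y, hY, ⟨r⟩⟩ =>
        ⟨Y⟦n⟧, P.le_shift n _ hY, ⟨r.map (shiftFunctor C n)⟩⟩⟩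
      toIsTriangulatedClosed₂ := .mk' fun T hT h₁ h₃ =>
        ObjectProperty.monotone_retractClosure
          (ObjectProperty.extensionProduct_le_of_isTriangulatedClosed₂ le_rfl le_rfl) _
          (ObjectProperty.extensionProduct_retractClosure_retractClosure_le P P _
            ⟨_, _, _, _, _, hT, h₁, h₃⟩) }
  isStableUnderRetracts := inferInstance
  closed_coproducts J hJ := isClosedUnderColimitsOfShape_discrete fun Y c hc h => by
    choose X hX r using h
    have := hP J hJ
    have hx := coproductIsCoproduct X
    refine ⟨_, prop_cofan_pt P hx hX, ⟨⟨Cofan.IsColimit.desc hc fun j => (r j).some.i ≫ Sigma.ι X j,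
      Cofan.IsColimit.desc hx fun j => (r j).some.r ≫ c.inj j, ?_⟩⟩⟩
    refine Cofan.IsColimit.hom_ext hc _ _ fun j => ?_
    have := Cofan.IsColimit.fac hx (fun j => (r j).some.r ≫ c.inj j) j
    dsimp at this
    rw [← Category.assoc, Cofan.IsColimit.fac, Category.assoc, this, Retract.retract_assoc,
      Category.comp_id]

/-- A triangulated subcategory that is closed under countable coproducts is closed under direct
factors. -/
theorem prop_of_retract_of_countable_coproducts (P : ObjectProperty C) [P.IsTriangulated]
    [P.IsClosedUnderIsomorphisms] [P.IsClosedUnderColimitsOfShape (Discrete ℕ)] {X Y : C}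
    [HasCoproduct fun _ : ℕ => X] (r : Retract Y X) (hX : P X) : P Y := by
  let A := ∐ fun _ : ℕ => X
  let ι (n : ℕ) : X ⟶ A := Sigma.ι (fun _ : ℕ => X) n
  have hA := coproductIsCoproduct fun _ : ℕ => X
  let e : X ⟶ X := r.r ≫ r.i
  have her : e ≫ r.r = r.r := by simp [e]
  have hee : e ≫ e = e := by simp [e]
  -- On the copies of X, u fixes the part 1 - e and moves the part e one copy up; v moves it back
  -- and kills it on copy 0. So u is a split monomorphism whose complement is the image Y of e in
  -- copy 0, and the cone of u is Y.
  let u : A ⟶ A := Sigma.desc fun n => (𝟙 X - e) ≫ ι n + e ≫ ι (n + 1)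
  let v : A ⟶ A := Sigma.desc fun n => (𝟙 X - e) ≫ ι n + Nat.casesOn n 0 fun n => e ≫ ι n
  let q : A ⟶ Y := Sigma.desc fun n => Nat.casesOn n r.r fun _ => 0
  let s : Y ⟶ A := r.i ≫ ι 0
  have hu (n : ℕ) : ι n ≫ u = (𝟙 X - e) ≫ ι n + e ≫ ι (n + 1) := Sigma.ι_desc _ _
  have hv₀ : ι 0 ≫ v = (𝟙 X - e) ≫ ι 0 := (Sigma.ι_desc _ _).trans (add_zero _)
  have hv (n : ℕ) : ι (n + 1) ≫ v = (𝟙 X - e) ≫ ι (n + 1) + e ≫ ι n := Sigma.ι_desc _ _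
  have hq₀ : ι 0 ≫ q = r.r := Sigma.ι_desc _ _
  have hq (n : ℕ) : ι (n + 1) ≫ q = 0 := Sigma.ι_desc _ _
  have ext {B : C} {f g : A ⟶ B} (h : ∀ n, ι n ≫ f = ι n ≫ g) : f = g :=
    Cofan.IsColimit.hom_ext hA _ _ h
  have huv : u ≫ v = 𝟙 A := ext fun n => by
    cases n <;> simp [reassoc_of% hu, hv₀, hv, reassoc_of% hee, Preadditive.sub_comp]
  have huq : u ≫ q = 0 := ext fun n => by
    cases n <;> simp [reassoc_of% hu, hq₀, hq, her, Preadditive.sub_comp]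
  have hvu : v ≫ u + q ≫ s = 𝟙 A := ext fun n => by
    cases n <;> simp [reassoc_of% hv₀, reassoc_of% hv, hu, reassoc_of% hq₀, reassoc_of% hq, s, e,
      Preadditive.sub_comp]
  have hsq : s ≫ q = 𝟙 Y := by simp [s, hq₀]
  obtain ⟨Z, p, z, hT⟩ := distinguished_cocone_triangle u
  have hz : z = 0 := by
    have : z ≫ u⟦(1 : ℤ)⟧' ≫ v⟦(1 : ℤ)⟧' = z := by
      rw [← Functor.map_comp, huv, CategoryTheory.Functor.map_id, Category.comp_id]
    rw [← this, reassoc_of% distTriang_comp₃₁ hT, zero_comp]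
  have hp : Epi p := Preadditive.epi_of_cancel_zero _ fun x hx => by
    obtain ⟨t, rfl⟩ := exists_desc₃ hT x hx
    rw [hz, zero_comp]
  obtain ⟨t, ht⟩ := exists_desc₂ hT q huq
  have hAP : P A := prop_cofan_pt P hA fun _ => hX
  refine P.prop_of_iso (⟨t, s ≫ p, ?_, ?_⟩ : Z ≅ Y) (P.ext_of_isTriangulatedClosed₃ _ hT hAP hAP)
  · rw [← cancel_epi p, ← reassoc_of% ht, Category.comp_id]
    calc q ≫ s ≫ p = (v ≫ u + q ≫ s) ≫ p := by
          rw [Preadditive.add_comp, Category.assoc v, distTriang_comp₁₂ hT, comp_zero, zero_add,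
            Category.assoc q]
      _ = p := by rw [hvu, Category.id_comp]
  · rw [Category.assoc, ← ht, hsq]

end RetractClosure

end WellGenerated

namespace WellGenerated

/-! ### The comparison functor J and its image -/

section Comparison

variable {C : Type u} [Category.{v} C] [HasZeroObject C] [HasShift C ℤ] [Preadditive C]
  [∀ n : ℤ, (shiftFunctor C n).Additive] [Pretriangulated C] [IsTriangulated C]
  (P S : ObjectProperty C) [P.IsTriangulated] [S.IsTriangulated] [S.IsClosedUnderIsomorphisms]

/-- The functor `P / (P ∩ S) ⥤ C / S` induced by the inclusion of `P` into `C`. -/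
noncomputable abbrev quotientFunctor :
    (S.inverseImage P.ι).trW.Localization ⥤ S.trW.Localization :=
  (P.triangulatedLocalizerMorphism S).localizedFunctor (S.inverseImage P.ι).trW.Q S.trW.Q

/-- The compatibility of `quotientFunctor` with the quotient functors. -/
noncomputable def quotientFunctorIso :
    (S.inverseImage P.ι).trW.Q ⋙ quotientFunctor P S ≅ P.ι ⋙ S.trW.Q :=
  (CatCommSq.iso (P.triangulatedLocalizerMorphism S).functor (S.inverseImage P.ι).trW.Q S.trW.Q
    (quotientFunctor P S)).symm

instance : NatTrans.CommShift (quotientFunctorIso P S).hom ℤ := by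
  unfold quotientFunctorIso
  have : NatTrans.CommShift (CatCommSq.iso (P.triangulatedLocalizerMorphism S).functor
    (S.inverseImage P.ι).trW.Q S.trW.Q (quotientFunctor P S)).hom ℤ := inferInstance
  exact NatTrans.CommShift.of_iso_inv _ _

instance : (quotientFunctor P S).IsTriangulated := by
  have := Localization.essSurj_mapArrow (S.inverseImage P.ι).trW.Q (S.inverseImage P.ι).trW
  exact Functor.isTriangulated_of_precomp_iso (quotientFunctorIso P S)

theorem map_Q_eq_essImage : P.map S.trW.Q = (quotientFunctor P S).essImage := by
  have := Localization.essSurj (S.inverseImage P.ι).trW.Q (S.inverseImage P.ι).trW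
  ext Y
  constructor
  · rintro ⟨X, hX, ⟨e⟩⟩
    exact ⟨_, ⟨(quotientFunctorIso P S).app ⟨X, hX⟩ ≪≫ e⟩⟩
  · rintro ⟨W, ⟨e⟩⟩
    let X := (S.inverseImage P.ι).trW.Q.objPreimage W
    exact ⟨_, X.property, ⟨(quotientFunctorIso P S).symm.app X ≪≫
      (quotientFunctor P S).mapIso ((S.inverseImage P.ι).trW.Q.objObjPreimageIso W) ≪≫ e⟩⟩

end Comparison

/-- Fullness matters: morphisms between objects of the image come from the source, and so do their
cones. -/
theorem isTriangulated_essImage {C D : Type*} [Category* C] [HasZeroObject C] [HasShift C ℤ]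
    [Preadditive C] [∀ n : ℤ, (shiftFunctor C n).Additive] [Pretriangulated C] [Category* D]
    [HasZeroObject D] [HasShift D ℤ] [Preadditive D] [∀ n : ℤ, (shiftFunctor D n).Additive]
    [Pretriangulated D] (F : C ⥤ D) [F.CommShift ℤ] [F.IsTriangulated] [F.Full] :
    F.essImage.IsTriangulated :=
  inferInstance

section Compact

variable {C : Type u} [Category.{v} C] [HasZeroObject C] [HasShift C ℤ] [Preadditive C]
  [∀ n : ℤ, (shiftFunctor C n).Additive] [Pretriangulated C] [IsTriangulated C]

theorem closed_coproducts_map_Q [HasCoproducts.{w} C] {P S : ObjectProperty C} [S.IsTriangulated]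
    (hS : IsLocalizing.{w} S) {J : Type w} (hP : P.IsClosedUnderColimitsOfShape (Discrete J)) :
    (P.map S.trW.Q).IsClosedUnderColimitsOfShape (Discrete J) := by
  have := preservesCoproducts_Q hS.closed_coproducts
  refine isClosedUnderColimitsOfShape_discrete fun Y c hc h => ?_
  choose X hX e using h
  have hx := coproductIsCoproduct X
  exact ⟨_, prop_cofan_pt P hx hX, ⟨IsColimit.coconePointUniqueUpToIso
    (isColimitMapCofan S.trW.Q hx) (isColimitIsoCofan (fun j => (e j).some) hc)⟩⟩

/-- For α > ℵ₀ the image is closed under countable coproducts, so the splitting argument applies. -/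
theorem prop_map_Q_of_retract [HasCoproducts.{w} C] {α : Cardinal.{w}} (hα : Cardinal.aleph0 < α)
    {P S : ObjectProperty C} [S.IsTriangulated] (hP : IsAlphaLocalizing α P)
    (hS : IsLocalizing.{w} S) [(P.map S.trW.Q).IsTriangulated] {X Y : S.trW.Localization}
    (r : Retract Y X) (hX : P.map S.trW.Q X) : P.map S.trW.Q Y := by
  have := closed_coproducts_map_Q hS (hP.closed_coproducts (ULift.{w} ℕ) (by simpa using hα))
  have e : Discrete (ULift.{w} ℕ) ≌ Discrete ℕ := Discrete.equivalence Equiv.ulift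
  have := ObjectProperty.IsClosedUnderColimitsOfShape.of_equivalence (P := P.map S.trW.Q) e
  have := hasCoproducts_quotient hS.closed_coproducts
  have : HasColimitsOfShape (Discrete ℕ) S.trW.Localization :=
    hasColimitsOfShape_of_equivalence e
  exact prop_of_retract_of_countable_coproducts _ r hX

end Compact

end WellGenerated

/-! ### Assembly of the theorem -/

theorem mainTheorem2 {T : Type u} [Category.{v} T] [HasZeroObject T] [HasShift T ℤ] [Preadditive T]
    [∀ n : ℤ, (shiftFunctor T n).Additive] [Pretriangulated T] [IsTriangulated T]
    (α : Cardinal.{w}) (hα : α.IsRegular)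
    -- `T` is `α`-well generated by `G`; so `LocAlpha α G` is its subcategory `T^α`
    (G : ObjectProperty T) (hG : IsWellGeneratedBy α G)
    -- `S = Loc S₀` is the localizing subcategory generated by a class `S₀` of `α`-compact objects
    (S₀ : ObjectProperty T) (hS₀ : S₀ ≤ LocAlpha α G) :
    -- membership in `S`
    (∀ X : T, Loc.{w} S₀ X ↔ ∀ (A : T) (f : A ⟶ X), LocAlpha α G A →
      ∃ (B : T) (a : A ⟶ B) (b : B ⟶ X), Loc.{w} S₀ B ∧ LocAlpha α G B ∧ a ≫ b = f) ∧
    -- `S` and `T / S` are `α`-well generated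
    IsWellGenerated (Loc.{w} S₀).FullSubcategory α ∧
    IsWellGenerated (Loc.{w} S₀).trW.Localization α ∧
    -- `S^α = S ∩ T^α`
    (∀ H : ObjectProperty (Loc.{w} S₀).FullSubcategory, IsWellGeneratedBy α H →
      LocAlpha α H = (LocAlpha α G).inverseImage (Loc.{w} S₀).ι) ∧
    -- the exact functor `J : T^α / S^α ⥤ T / S` induced by the inclusion `T^α ⥤ T`, where `S^α`
    -- is viewed as a full subcategory of `T^α`
    (∃ (J : ((Loc.{w} S₀).inverseImage (LocAlpha α G).ι).trW.Localization ⥤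
          (Loc.{w} S₀).trW.Localization)
        (_ : J.CommShift ℤ)
        (e : ((Loc.{w} S₀).inverseImage (LocAlpha α G).ι).trW.Q ⋙ J ≅
          (LocAlpha α G).ι ⋙ (Loc.{w} S₀).trW.Q),
      NatTrans.CommShift e.hom ℤ ∧ J.IsTriangulated ∧ J.Full ∧ J.Faithful ∧
      -- `J` takes values in `(T / S)^α`, all of whose objects are direct factors of objects in the
      -- image of `J`, and `T^α / S^α ⥤ (T / S)^α` is an equivalence if `α > ℵ₀`
      ∀ H : ObjectProperty (Loc.{w} S₀).trW.Localization, IsWellGeneratedBy α H →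
        ∃ hJ : ∀ X, LocAlpha α H (J.obj X),
          (∀ Y, LocAlpha α H Y → ∃ X, Nonempty (Retract Y (J.obj X))) ∧
          (Cardinal.aleph0 < α → ((LocAlpha α H).lift J hJ).IsEquivalence)) := by
  have := hG.locallySmall
  have := hG.hasCoproducts
  have := hG.small
  have hP : IsAlphaLocalizing α (LocAlpha α G) := isAlphaLocalizing_locAlpha α G
  have hP' : LocAlpha α G ≤ IsDecomposable α (LocAlpha α G) := hG.locAlpha_le_isDecomposable hα
  have hPs := locAlpha_essentiallySmall hα G
  have hS : IsLocalizing.{w} (Loc.{w} S₀) := isLocalizing_loc S₀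
  have hNP : LocAlpha α S₀ ≤ LocAlpha α G := locAlpha_le hP hS₀
  have hNS := locAlpha_le_loc α S₀
  have hfac := loc_le_factorsThrough hP hP' hS₀
  have hgen (R : ObjectProperty T) (hR : IsLocalizing.{w} R) (h : LocAlpha α G ≤ R) (X : T) :
      R X := hG.generates R hR ((le_locAlpha α G).trans h) X
  -- Besides controlling fractions, this criterion yields the fullness and faithfulness of J.
  have hV : (LocAlpha α G).IsVerdierLeftLocalizing (Loc.{w} S₀) := ⟨fun {X Y} f hX hY => by
    obtain ⟨B, a, b, hB, fac⟩ := hfac Y hY X f hX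
    exact ⟨B, a, b, hNP _ hB, hNS _ hB, fac⟩⟩
  obtain ⟨H₀, hH₀, hH₀', hw⟩ := exists_isWellGeneratedBy_quotient hS hP' hgen
  obtain ⟨H₁, -, -, hw₁⟩ := exists_isWellGeneratedBy_loc hP hP' hS₀
  have hQ := preservesCoproducts_Q hS.closed_coproducts
  have hQ' := Localization.essSurj (Loc.{w} S₀).trW.Q (Loc.{w} S₀).trW
  refine ⟨fun X => ⟨fun hX A f hA => ?_, fun hX => ?_⟩, ⟨H₁, hw₁⟩, ⟨H₀, hw⟩, fun H hH =>
    locAlpha_eq_inverseImage_ι hα hP hP' hS₀ hH, quotientFunctor _ _, inferInstance,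
    quotientFunctorIso _ _, inferInstance, inferInstance, inferInstance, inferInstance,
    fun H hH => ?_⟩
  · obtain ⟨B, a, b, hB, fac⟩ := hfac X hX A f hA
    exact ⟨B, a, b, hNS _ hB, hNP _ hB, fac⟩
  · refine FactorsThrough.prop (P := LocAlpha α G) hS hgen fun A f hA => ?_
    obtain ⟨B, a, b, hB, hB', fac⟩ := hX A f hA
    exact ⟨B, a, b, ⟨hB, hB'⟩, fac⟩
  · have hE := map_Q_eq_essImage (LocAlpha α G) (Loc.{w} S₀)
    have hEt : ((LocAlpha α G).map (Loc.{w} S₀).trW.Q).IsTriangulated := by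
      rw [hE]
      exact isTriangulated_essImage _
    have hEα : (LocAlpha α G).map (Loc.{w} S₀).trW.Q ≤ LocAlpha α H := by
      rw [hw.locAlpha_eq hα hH]
      exact hH₀'.trans ((ObjectProperty.isoClosure_le_iff _ _).2 (le_locAlpha α H₀))
    -- The retract closure of the image is α-localizing and contains the generators H₀, and
    -- α-compactness does not depend on the choice between H₀ and H.
    have hαE : LocAlpha α H ≤ ((LocAlpha α G).map (Loc.{w} S₀).trW.Q).retractClosure := by
      have := hH.hasCoproducts
      rw [hw.locAlpha_eq hα hH]
      exact locAlpha_le (isAlphaLocalizing_retractClosure _ fun J hJ =>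
        closed_coproducts_map_Q hS (hP.closed_coproducts J hJ))
        (hH₀.trans (ObjectProperty.le_retractClosure _))
    have hJ X : LocAlpha α H ((quotientFunctor (LocAlpha α G) (Loc.{w} S₀)).obj X) :=
      hEα _ (hE ▸ Functor.obj_mem_essImage _ X)
    refine ⟨hJ, fun Y hY => ?_, fun hα' => ?_⟩
    · obtain ⟨Z, hZ, ⟨r⟩⟩ := hαE Y hY
      rw [hE] at hZ
      obtain ⟨X, ⟨e⟩⟩ := hZ
      exact ⟨X, ⟨r.trans (Retract.ofIso e.symm)⟩⟩
    · have : ((LocAlpha α H).lift _ hJ).EssSurj := ⟨fun Y => by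
        obtain ⟨Z, hZ, ⟨r⟩⟩ := hαE Y.obj Y.property
        have hY := prop_map_Q_of_retract hα' hP hS r hZ
        rw [hE] at hY
        obtain ⟨X, ⟨e⟩⟩ := hY
        exact ⟨X, ⟨(LocAlpha α H).fullyFaithfulι.preimageIso e⟩⟩⟩
      exact { }
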